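/- Consider the linear system $x_{k+1}=Ax_k+w_k$, $y_k=Cx_k+v_k$ ($k\ge 0$, $x_k\in\mathbb R^n$, $y_k\in\mathbb R^m$), where $x_0\sim\mathcal N(0,\Pi_0)$, the $w_k\sim\mathcal N(0,Q)$ and the $v_k\sim\mathcal N(0,R)$ are mutually independent, $\Pi_0,Q\succeq 0$, $R\succ 0$. Let $\hat x^s_k=\mathbb E[x_k\mid y_1,\dots,y_k]$ be the sensor's local estimate, and suppose the local filter is in steady state: there is a constant matrix $\overline P$ with $\mathbb E[(x_k-\hat x^s_k)(x_k-\hat x^s_k)'\mid y_1,\dots,y_k]=\overline P$ a.s. for all $k\ge 0$. Put $h(X)=AXA'+Q$, and let $X^{+}$ denote the Moore–Penrose pseudoinverse of $X$. At each time $k\ge1$ the sensor sends $\hat x^s_k$ with power $\omega_k\ge 0$; $\gamma_k\in\{0,1\}$ indicates whether the packet arrives ($\gamma_k=1$) or is dropped ($\gamma_k=0$), and $\gamma_0=1$. The channel is memoryless and its noise is independent of the plant: conditionally on $x_0$, all $w_j$, all $v_j$, and $\gamma_1,\dots,\gamma_{k-1}$, the packet is dropped with probability $q^{\omega_k}$,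 where $q=\exp(-\alpha/(N_0W))$, $N_0,W>0$, $\alpha\in(0,1]$. Let $\mathrm I_k$ be the $\sigma$-algebra generated by $\gamma_t$ and $\gamma_t\hat x^s_t$, $1\le t\le k$. For $k\ge1$ define the holding time $\tau=\tau(k)=k-\max\{0\le t\le k-1:\gamma_t=1\}$ and the incremental innovation $\varepsilon_k=\hat x^s_k-A^{\tau}\hat x^s_{k-\tau}$. The quadratic data-driven power controller $\theta_{\rm ef}$ is $$\omega_k=\frac{N_0W}{2\alpha}\,\varepsilon_k'\mathcal Q_\tau\varepsilon_k+\omega,$$ with weights $\mathcal Q_\tau\succeq0$ ($\tau\ge1$) and a constant $\omega\ge0$. Let $\Psi_0=0$ and, for $\tau\ge1$, $$\Sigma_\tau=A\Psi_{\tau-1}A'+\bigl(h(\overline P)-\overline P\bigr),\qquad \Psi_\tau=\bigl(\mathcal Q_\tau+\Sigma_\tau^{+}\bigr)^{+},$$ and assume that the weights are such that $\Sigma_\tau\succeq\Psi_\tau$ for all $\tau\ge1$. Then, under $\theta_{\rm ef}$, $\Sigma_\tau\succeq0$ and $\Psi_\tau\succeq 0$ for all $\tau\ge1$, and for every $k\ge1$: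 1. the conditional law of $\varepsilon_k$ given $\mathrm I_{k-1}$ is $\mathcal N(0,\Sigma_{\tau(k)})$; 2. the event $\{\gamma_k=0\}$ has positive probability, and the conditional law of $\varepsilon_k$ given $\mathrm I_{k-1}$ and $\gamma_k=0$ is $\mathcal N(0,\Psi_{\tau(k)})$. (Gaussian laws may be degenerate.) -/

import Mathlib

open MeasureTheory ProbabilityTheory Matrix

noncomputable section

namespace RemoteEstimation

/-! ### Moore-Penrose pseudoinverse -/

/-- The four Penrose equations: `X` is the Moore-Penrose pseudoinverse of the real matrix `M`. -/
structure IsMoorePenrose {n : ℕ} (M X : Matrix (Fin n) (Fin n) ℝ) : Prop where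
  mul_mul : M * X * M = M
  mul_mul' : X * M * X = X
  symm_left : (M * X)ᵀ = M * X
  symm_right : (X * M)ᵀ = X * M

theorem IsMoorePenrose.unique {n : ℕ} {M X Y : Matrix (Fin n) (Fin n) ℝ}
    (hX : IsMoorePenrose M X) (hY : IsMoorePenrose M Y) : X = Y := by
  have h1 : M * X = M * Y := by
    calc M * X = (M * X)ᵀ := hX.symm_left.symm
      _ = ((M * Y) * (M * X))ᵀ := by rw [← Matrix.mul_assoc (M * Y), hY.mul_mul]
      _ = (M * X)ᵀ * (M * Y)ᵀ := by rw [Matrix.transpose_mul]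
      _ = (M * X) * (M * Y) := by rw [hX.symm_left, hY.symm_left]
      _ = M * Y := by rw [← Matrix.mul_assoc, hX.mul_mul]
  have h2 : X * M = Y * M := by
    calc X * M = (X * M)ᵀ := hX.symm_right.symm
      _ = ((X * M) * (Y * M))ᵀ := by
          rw [Matrix.mul_assoc X M, ← Matrix.mul_assoc M Y M, hY.mul_mul]
      _ = (Y * M)ᵀ * (X * M)ᵀ := by rw [Matrix.transpose_mul]
      _ = (Y * M) * (X * M) := by rw [hX.symm_right, hY.symm_right]
      _ = Y * M := by rw [Matrix.mul_assoc Y M, ← Matrix.mul_assoc M X M, hX.mul_mul]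
  calc X = X * M * X := hX.mul_mul'.symm
    _ = Y * M * Y := by rw [h2, Matrix.mul_assoc, h1, ← Matrix.mul_assoc]
    _ = Y := hY.mul_mul'

theorem exists_isMoorePenrose {n : ℕ} (M : Matrix (Fin n) (Fin n) ℝ) :
    ∃ X, IsMoorePenrose M X := by
  have hG : (Mᵀ * M).IsHermitian := by
    simpa using Matrix.isHermitian_conjTranspose_mul_self M
  set U : Matrix (Fin n) (Fin n) ℝ := (hG.eigenvectorUnitary : Matrix (Fin n) (Fin n) ℝ) with hU
  set D : Matrix (Fin n) (Fin n) ℝ := Matrix.diagonal hG.eigenvalues with hD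
  set E : Matrix (Fin n) (Fin n) ℝ := Matrix.diagonal (fun i => (hG.eigenvalues i)⁻¹) with hE
  have hUU : Uᵀ * U = 1 := by
    have := Unitary.coe_star_mul_self hG.eigenvectorUnitary
    simpa [Matrix.star_eq_conjTranspose] using this
  have hspec : Mᵀ * M = U * D * Uᵀ := by
    have := hG.spectral_theorem
    simpa [Unitary.conjStarAlgAut_apply, Matrix.star_eq_conjTranspose, Function.comp_def] using this
  have hDE : D * E = E * D := by
    simp only [hD, hE, Matrix.diagonal_mul_diagonal, mul_comm]
  have hDED : D * E * D = D := by
    simp only [hD, hE, Matrix.diagonal_mul_diagonal]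
    congr 1; funext i; by_cases h : hG.eigenvalues i = 0 <;> simp [h]
  have hEDE : E * D * E = E := by
    simp only [hD, hE, Matrix.diagonal_mul_diagonal]
    congr 1; funext i; by_cases h : hG.eigenvalues i = 0 <;> simp [h]
  have hEt : Eᵀ = E := by simp [hE]
  have hDt : Dᵀ = D := by simp [hD]
  set H : Matrix (Fin n) (Fin n) ℝ := U * E * Uᵀ with hH
  have key : ∀ S T : Matrix (Fin n) (Fin n) ℝ,
      (U * S * Uᵀ) * (U * T * Uᵀ) = U * (S * T) * Uᵀ := by
    intro S T
    calc (U * S * Uᵀ) * (U * T * Uᵀ) = U * S * (Uᵀ * U) * T * Uᵀ := by noncomm_ring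
      _ = _ := by rw [hUU]; noncomm_ring
  have hHt : Hᵀ = H := by
    rw [hH, Matrix.transpose_mul, Matrix.transpose_mul, hEt, Matrix.transpose_transpose,
      Matrix.mul_assoc]
  have hHG : H * (Mᵀ * M) = U * (E * D) * Uᵀ := by rw [hspec, hH, key]
  have hHGt : (H * (Mᵀ * M))ᵀ = H * (Mᵀ * M) := by
    rw [hHG, Matrix.transpose_mul, Matrix.transpose_mul, Matrix.transpose_mul, hEt, hDt, hDE,
      Matrix.transpose_transpose]
    noncomm_ring
  have hGHG : (Mᵀ * M) * (H * (Mᵀ * M)) = Mᵀ * M := by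
    rw [hHG, hspec, key, ← Matrix.mul_assoc D E D, hDED]
  have hHGH : H * (Mᵀ * M) * H = H := by rw [hHG, hH, key, hEDE]
  have hM : M * (H * (Mᵀ * M)) = M := by
    have h0 : (M * (H * (Mᵀ * M)) - M)ᵀ * (M * (H * (Mᵀ * M)) - M) = 0 := by
      have : (M * (H * (Mᵀ * M)) - M)ᵀ * (M * (H * (Mᵀ * M)) - M)
          = (H * (Mᵀ * M))ᵀ * ((Mᵀ * M) * (H * (Mᵀ * M)) - Mᵀ * M)
            - ((Mᵀ * M) * (H * (Mᵀ * M)) - Mᵀ * M) := by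
        rw [Matrix.transpose_sub, Matrix.transpose_mul M]
        noncomm_ring
      rw [this, hGHG]; simp
    have h1 : (M * (H * (Mᵀ * M)) - M)ᴴ * (M * (H * (Mᵀ * M)) - M) = 0 := by
      simpa using h0
    exact sub_eq_zero.mp (Matrix.conjTranspose_mul_self_eq_zero.mp h1)
  refine ⟨H * Mᵀ, ?_, ?_, ?_, ?_⟩
  · calc M * (H * Mᵀ) * M = M * (H * (Mᵀ * M)) := by noncomm_ring
      _ = M := hM
  · calc H * Mᵀ * M * (H * Mᵀ) = (H * (Mᵀ * M) * H) * Mᵀ := by noncomm_ring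
      _ = H * Mᵀ := by rw [hHGH]
  · rw [Matrix.transpose_mul, Matrix.transpose_mul, hHt, Matrix.transpose_transpose,
      Matrix.mul_assoc]
  · rw [Matrix.mul_assoc, hHGt]

/-- The Moore-Penrose pseudoinverse of a real square matrix. -/
def pinv {n : ℕ} (M : Matrix (Fin n) (Fin n) ℝ) : Matrix (Fin n) (Fin n) ℝ :=
  (exists_isMoorePenrose M).choose

theorem isMoorePenrose_pinv {n : ℕ} (M : Matrix (Fin n) (Fin n) ℝ) :
    IsMoorePenrose M (pinv M) :=
  (exists_isMoorePenrose M).choose_spec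

/-! ### Conditional laws -/

/-- `ν` is a (regular) conditional law of `X` given the sub-σ-algebra `m`, under `μ`:
for every Borel set `B`, `ω ↦ ν ω B` is `m`-measurable and is a version of `μ(X ∈ B | m)`. -/
def HasCondLaw {Ω E : Type*} [mΩ : MeasurableSpace Ω] [MeasurableSpace E] (μ : Measure Ω)
    (X : Ω → E) (m : MeasurableSpace Ω) (ν : Ω → Measure E) : Prop :=
  ∀ B : Set E, MeasurableSet B →
    Measurable[m] (fun ω => ν ω B) ∧
    μ[(X ⁻¹' B).indicator (fun _ => (1 : ℝ)) | m] =ᵐ[μ] fun ω => (ν ω).real B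

/-! ### The plant, the sensor and the remote estimator -/

/-- A matrix acting on Euclidean vectors. -/
def act {a b : ℕ} (M : Matrix (Fin a) (Fin b) ℝ) (x : EuclideanSpace ℝ (Fin b)) :
    EuclideanSpace ℝ (Fin a) :=
  WithLp.toLp 2 (M *ᵥ x.ofLp)

/-- The parameters of the system, of the channel and of the power controller. -/
structure Parameters (n m : ℕ) where
  /-- state matrix -/
  A : Matrix (Fin n) (Fin n) ℝ
  /-- observation matrix -/
  C : Matrix (Fin m) (Fin n) ℝ
  /-- covariance of the state noise -/
  Q : Matrix (Fin n) (Fin n) ℝ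
  /-- covariance of the observation noise -/
  R : Matrix (Fin m) (Fin m) ℝ
  /-- covariance of the initial state -/
  Pi0 : Matrix (Fin n) (Fin n) ℝ
  /-- noise power spectral density -/
  N0 : ℝ
  /-- channel bandwidth -/
  W : ℝ
  /-- modulation constant -/
  α : ℝ
  /-- weight matrices of the controller, indexed by the holding time `τ ≥ 1` -/
  wt : ℕ → Matrix (Fin n) (Fin n) ℝ
  /-- constant term of the transmission power -/
  pow0 : ℝ
  Q_posSemidef : Q.PosSemidef
  R_posDef : R.PosDef
  Pi0_posSemidef : Pi0.PosSemidef
  N0_pos : 0 < N0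
  W_pos : 0 < W
  α_pos : 0 < α
  α_le_one : α ≤ 1
  wt_posSemidef : ∀ τ, 1 ≤ τ → (wt τ).PosSemidef
  pow0_nonneg : 0 ≤ pow0

/-- The map `h(X) = A X A' + Q`. -/
def Parameters.h {n m : ℕ} (p : Parameters n m) (X : Matrix (Fin n) (Fin n) ℝ) :
    Matrix (Fin n) (Fin n) ℝ :=
  p.A * X * p.Aᵀ + p.Q

/-- The channel constant `q = exp (-α / (N₀ W))`. -/
def Parameters.q {n m : ℕ} (p : Parameters n m) : ℝ := Real.exp (-p.α / (p.N0 * p.W))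

/-- The random inputs: initial state, state noise, observation noise, and the
reception indicators `γ` (`1` for reception, `0` for a drop). -/
structure Signals (n m : ℕ) (Ω : Type*) where
  x0 : Ω → EuclideanSpace ℝ (Fin n)
  w : ℕ → Ω → EuclideanSpace ℝ (Fin n)
  v : ℕ → Ω → EuclideanSpace ℝ (Fin m)
  γ : ℕ → Ω → ℝ

section processes

variable {n m : ℕ} {Ω : Type*} [mΩ : MeasurableSpace Ω]
  (p : Parameters n m) (s : Signals n m Ω) (μ : Measure Ω)

/-- State process: `x_{k+1} = A x_k + w_k`. -/
def state : ℕ → Ω → EuclideanSpace ℝ (Fin n)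
  | 0 => s.x0
  | k + 1 => fun ω => act p.A (state k ω) + s.w k ω

/-- Measurements: `y_k = C x_k + v_k`. -/
def meas (k : ℕ) (ω : Ω) : EuclideanSpace ℝ (Fin m) :=
  act p.C (state p s k ω) + s.v k ω

/-- The σ-algebra generated by `y_1, …, y_k`. -/
abbrev sensorInfo (k : ℕ) : MeasurableSpace Ω :=
  ⨆ t ∈ Finset.Icc 1 k, MeasurableSpace.comap (meas p s t) inferInstance

/-- The sensor's local estimate `E[x_k | y_1, …, y_k]`. -/
def localEst (k : ℕ) : Ω → EuclideanSpace ℝ (Fin n) :=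
  μ[state p s k | sensorInfo p s k]

/-- The sensor's local estimation error `x_k - E[x_k | y_1, …, y_k]`. -/
def localErr (k : ℕ) (ω : Ω) : EuclideanSpace ℝ (Fin n) :=
  state p s k ω - localEst p s μ k ω

/-- The local filter is in steady state: for every `k ≥ 0`, the conditional error covariance
`E[e_k e_k' | y_1, …, y_k]` is almost surely the constant matrix `Pbar`. -/
def SteadyState (Pbar : Matrix (Fin n) (Fin n) ℝ) : Prop :=
  ∀ (k : ℕ) (i j : Fin n),
    μ[fun ω => localErr p s μ k ω i * localErr p s μ k ω j | sensorInfo p s k]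
      =ᵐ[μ] fun _ => Pbar i j

/-- The holding time `τ(k) = k - max {t ≤ k - 1 : γ_t = 1}` (with `γ_0 = 1`), for `k ≥ 1`. -/
def holdingTime (k : ℕ) (ω : Ω) : ℕ :=
  open Classical in k - Nat.findGreatest (fun t => s.γ t ω = 1) (k - 1)

/-- The incremental innovation: local estimate at time `k` minus its prediction `A^τ` times
the local estimate at time `k - τ`. -/
def innov (k : ℕ) (ω : Ω) : EuclideanSpace ℝ (Fin n) :=
  localEst p s μ k ω
    - act (p.A ^ holdingTime s k ω) (localEst p s μ (k - holdingTime s k ω) ω)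

/-- The quadratic data-driven power controller. -/
def power (k : ℕ) (ω : Ω) : ℝ :=
  p.N0 * p.W / (2 * p.α)
      * ((innov p s μ k ω).ofLp ⬝ᵥ (p.wt (holdingTime s k ω) *ᵥ (innov p s μ k ω).ofLp))
    + p.pow0

/-- The information of the remote estimator up to time `k`: the σ-algebra generated by
`γ_1, …, γ_k` and the received local estimates `γ_1 x̂_1, …, γ_k x̂_k`. -/
abbrev remoteInfo (k : ℕ) : MeasurableSpace Ω :=
  ⨆ t ∈ Finset.Icc 1 k,
    (MeasurableSpace.comap (s.γ t) inferInstance ⊔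
      MeasurableSpace.comap (fun ω => s.γ t ω • localEst p s μ t ω) inferInstance)

/-- The σ-algebra generated by the initial state, all state and observation noises, and the
channel outcomes `γ_1, …, γ_{k-1}` strictly before time `k`. -/
abbrev preChannelInfo (k : ℕ) : MeasurableSpace Ω :=
  MeasurableSpace.comap s.x0 inferInstance ⊔
    (⨆ j, MeasurableSpace.comap (s.w j) inferInstance) ⊔
    (⨆ j, MeasurableSpace.comap (s.v j) inferInstance) ⊔
    ⨆ t ∈ Finset.Ico 1 k, MeasurableSpace.comap (s.γ t) inferInstance

/-- The closed-loop probabilistic model: independent Gaussian initial state and noises, and a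
memoryless channel, with noise independent of the plant, which drops the packet sent at time `k`
with probability `q ^ ω_k`, the power `ω_k` being chosen by the quadratic controller. -/
structure ClosedLoop : Prop where
  measurable_x0 : Measurable s.x0
  measurable_w : ∀ k, Measurable (s.w k)
  measurable_v : ∀ k, Measurable (s.v k)
  measurable_γ : ∀ k, Measurable (s.γ k)
  law_x0 : μ.map s.x0 = multivariateGaussian 0 p.Pi0
  law_w : ∀ k, μ.map (s.w k) = multivariateGaussian 0 p.Q
  law_v : ∀ k, μ.map (s.v k) = multivariateGaussian 0 p.R
  indep_w : iIndepFun s.w μ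
  indep_v : iIndepFun s.v μ
  indep_w_v : IndepFun (fun ω k => s.w k ω) (fun ω k => s.v k ω) μ
  indep_x0 : IndepFun s.x0 (fun ω => ((fun k => s.w k ω), (fun k => s.v k ω))) μ
  γ_zero : ∀ ω, s.γ 0 ω = 1
  γ_mem : ∀ k ω, s.γ k ω = 0 ∨ s.γ k ω = 1
  channel : ∀ k, 1 ≤ k →
    μ[(s.γ k ⁻¹' {0}).indicator (fun _ => (1 : ℝ)) | preChannelInfo s k]
      =ᵐ[μ] fun ω => p.q ^ power p s μ k ω

end processes

end RemoteEstimation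

end

/-! Let z_k = x̂_{k+1} - A x̂_k be the one-step innovation of the sensor's filter and e_k its error.
All variables of the filter are, almost surely, linear in the initial state and finitely many
noises, hence jointly Gaussian, so uncorrelated means independent. From z_k = A e_k + w_k - e_{k+1},
z_k is independent of y_1, …, y_k. Since z_k is also independent of e_{k+1}, the identity A e_k +
w_k = z_k + e_{k+1} gives z_k the covariance h(P̄) - P̄ (`map_stepInnov`). Independence survives
adjoining γ_1, …, γ_k, because each drop probability depends only on earlier measurements and
channel outcomes (`indep_sensorChannelInfo_stepInnov`).

The incremental innovation restarts from z_k after a reception and obeys ε_{k+1} = A ε_k + z_k after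
a drop; the second case sends a covariance Ψ to A Ψ A' + h(P̄) - P̄. A drop has conditional
probability proportional to exp(-ε' W ε / 2), where W is the current weight, so conditioning on it
tilts the law of ε by this factor. The tilt sends N(0, S) to N(0, (W + S⁺)⁺)
(`exists_withDensity_multivariateGaussian`). For singular S this needs the range of W to lie in that
of S, which is what S ⪰ (W + S⁺)⁺ forces: if S x = 0, the inequality puts x in the kernel of (W +
S⁺)⁺, hence of W + S⁺, hence of W.

A dropped packet tells the estimator nothing besides the drop itself, because γ x̂ = 0 there; every
event of the new information coincides on the drop with an event of the old one. The induction on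
time therefore runs over all events F of the remote information and all values t of the holding
time, with the claim that ε has law N(0, Σ_t) on F ∩ {τ = t}, up to total mass
(`map_innov_restrict`). Summing over t gives the conditional laws. -/

namespace RemoteEstimation

/-! ### Pseudoinverses of positive semidefinite matrices. -/

section Pseudoinverse

variable {n : ℕ} {M S W B : Matrix (Fin n) (Fin n) ℝ}

lemma pinv_transpose (M : Matrix (Fin n) (Fin n) ℝ) : (pinv M)ᵀ = pinv Mᵀ := by
  have h := isMoorePenrose_pinv M
  refine IsMoorePenrose.unique ⟨?_, ?_, ?_, ?_⟩ (isMoorePenrose_pinv Mᵀ)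
  · rw [← Matrix.transpose_mul, ← Matrix.transpose_mul, ← Matrix.mul_assoc, h.mul_mul]
  · rw [← Matrix.transpose_mul, ← Matrix.transpose_mul, ← Matrix.mul_assoc, h.mul_mul']
  · rw [← Matrix.transpose_mul, h.symm_right, h.symm_right]
  · rw [← Matrix.transpose_mul, h.symm_left, h.symm_left]

lemma transpose_eq_of_posSemidef (hM : M.PosSemidef) : Mᵀ = M := by
  rw [← Matrix.conjTranspose_eq_transpose_of_trivial]; exact hM.isHermitian

lemma pinv_isSymm (hM : Mᵀ = M) : (pinv M)ᵀ = pinv M := by rw [pinv_transpose, hM]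

lemma pinv_mul_comm (hM : Mᵀ = M) : pinv M * M = M * pinv M := by
  conv_lhs => rw [← (isMoorePenrose_pinv M).symm_right, Matrix.transpose_mul, hM, pinv_isSymm hM]

/-- For symmetric M the identity M⁺ = M⁺ M M⁺ exhibits M⁺ as a congruence of M. -/
lemma pinv_posSemidef (hM : M.PosSemidef) : (pinv M).PosSemidef := by
  have hs := transpose_eq_of_posSemidef hM
  have h := hM.mul_mul_conjTranspose_same (pinv M)
  rwa [Matrix.conjTranspose_eq_transpose_of_trivial, pinv_isSymm hs,
    (isMoorePenrose_pinv M).mul_mul'] at h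

/-- If `S ⪰ (W + S⁺)⁺`, then the range of `W` lies in the range of `S`. -/
lemma mul_pinv_mul_self_of_posSemidef_sub (hS : S.PosSemidef) (hW : W.PosSemidef)
    (h : (S - pinv (W + pinv S)).PosSemidef) : W * (pinv S * S) = W := by
  have hS' := pinv_posSemidef hS
  have hN : (W + pinv S).PosSemidef := hW.add hS'
  have hK := pinv_posSemidef hN
  have hSP : S * (1 - pinv S * S) = 0 := by
    rw [Matrix.mul_sub, ← Matrix.mul_assoc, (isMoorePenrose_pinv S).mul_mul, Matrix.mul_one,
      sub_self]
  suffices hz : W * (1 - pinv S * S) = 0 by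
    rw [Matrix.mul_sub, Matrix.mul_one, sub_eq_zero] at hz
    exact hz.symm
  -- The columns of 1 - S⁺ S lie in the kernel of S, so it is enough that W vanishes on that kernel.
  refine Matrix.ext_of_mulVec_single fun i => ?_
  rw [Matrix.zero_mulVec, ← Matrix.mulVec_mulVec]
  set x := (1 - pinv S * S) *ᵥ Pi.single i 1 with hx
  have hSx : S *ᵥ x = 0 := by rw [hx, Matrix.mulVec_mulVec, hSP, Matrix.zero_mulVec]
  have hKx : pinv (W + pinv S) *ᵥ x = 0 := by
    rw [← hK.dotProduct_mulVec_zero_iff]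
    have h1 := h.dotProduct_mulVec_nonneg x
    have h2 := hK.dotProduct_mulVec_nonneg x
    rw [Matrix.sub_mulVec, hSx, zero_sub, dotProduct_neg] at h1
    linarith
  -- A symmetric N satisfies N = N N N⁺, so the kernel of N⁺ is contained in the kernel of N.
  have hNx : (W + pinv S) *ᵥ x = 0 := by
    have h1 : (W + pinv S) * (W + pinv S) * pinv (W + pinv S) = W + pinv S := by
      rw [Matrix.mul_assoc, ← pinv_mul_comm (transpose_eq_of_posSemidef hN), ← Matrix.mul_assoc,
        (isMoorePenrose_pinv _).mul_mul]
    rw [← h1, ← Matrix.mulVec_mulVec, hKx, Matrix.mulVec_zero]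
  rw [← hW.dotProduct_mulVec_zero_iff]
  have h1 := hW.dotProduct_mulVec_nonneg x
  have h2 := hS'.dotProduct_mulVec_nonneg x
  have h3 : star x ⬝ᵥ ((W + pinv S) *ᵥ x) = 0 := by rw [hNx, dotProduct_zero]
  rw [Matrix.add_mulVec, dotProduct_add] at h3
  linarith

/-- For `S = B²` with `B` symmetric and the range of `W` in the range of `S`,
`(W + S⁺)⁺ = B (1 + B W B)⁻¹ B`. -/
lemma pinv_add_pinv_eq (hB : Bᵀ = B) (hBB : B * B = S) (hW : W.PosSemidef)
    (hWS : W * (pinv S * S) = W) :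
    pinv (W + pinv S) = B * (1 + B * W * B)⁻¹ * B := by
  have hSt : Sᵀ = S := by rw [← hBB, Matrix.transpose_mul, hB]
  have hWt := transpose_eq_of_posSemidef hW
  have hP := isMoorePenrose_pinv S
  set P := pinv S * S with hPdef
  have hPt : Pᵀ = P := hP.symm_right
  have hPW : P * W = W := by
    have := congrArg Matrix.transpose hWS
    rwa [Matrix.transpose_mul, hPt, hWt] at this
  have hPS : P * S = S := by rw [hPdef, pinv_mul_comm hSt, hP.mul_mul]
  -- P is the orthogonal projection onto the range of S = B Bᵀ, which is also the range of B.
  have hPB : P * B = B := by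
    have h0 : ((1 - P) * B) * ((1 - P) * B)ᴴ = 0 := by
      rw [Matrix.conjTranspose_eq_transpose_of_trivial, Matrix.transpose_mul, hB,
        Matrix.mul_assoc, ← Matrix.mul_assoc B, hBB, ← Matrix.mul_assoc, Matrix.sub_mul, hPS,
        Matrix.one_mul, sub_self, Matrix.zero_mul]
    have h1 := Matrix.self_mul_conjTranspose_eq_zero.mp h0
    rw [Matrix.sub_mul, Matrix.one_mul, sub_eq_zero] at h1
    exact h1.symm
  have hJ : (1 + B * W * B).PosDef := by
    refine Matrix.PosDef.one.add_posSemidef ?_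
    have := hW.mul_mul_conjTranspose_same B
    rwa [Matrix.conjTranspose_eq_transpose_of_trivial, hB] at this
  have hJu : IsUnit (1 + B * W * B).det := (Matrix.isUnit_iff_isUnit_det _).mp hJ.isUnit
  have hJt : ((1 + B * W * B)⁻¹)ᵀ = (1 + B * W * B)⁻¹ :=
    transpose_eq_of_posSemidef hJ.inv.posSemidef
  have hKt : (B * (1 + B * W * B)⁻¹ * B)ᵀ = B * (1 + B * W * B)⁻¹ * B := by
    rw [Matrix.transpose_mul, Matrix.transpose_mul, hJt, hB]
    simp only [Matrix.mul_assoc]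
  have hNt : (W + pinv S)ᵀ = W + pinv S := by rw [Matrix.transpose_add, hWt, pinv_isSymm hSt]
  -- With N = W + S⁺, this factorization makes N times the candidate equal to P, from which all four
  -- Penrose equations follow.
  have hNB : (W + pinv S) * B = pinv S * B * (1 + B * W * B) := by
    have : pinv S * B * (1 + B * W * B) = pinv S * B + pinv S * (B * B) * W * B := by noncomm_ring
    rw [this, hBB, hPW]
    noncomm_ring
  have hNK : (W + pinv S) * (B * (1 + B * W * B)⁻¹ * B) = P := by
    rw [← Matrix.mul_assoc, ← Matrix.mul_assoc, hNB, Matrix.mul_assoc (pinv S * B),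
      Matrix.mul_nonsing_inv _ hJu, Matrix.mul_one, Matrix.mul_assoc, hBB]
  have hKN : (B * (1 + B * W * B)⁻¹ * B) * (W + pinv S) = P := by
    have := congrArg Matrix.transpose hNK
    rwa [Matrix.transpose_mul, hKt, hNt, hPt] at this
  refine IsMoorePenrose.unique (isMoorePenrose_pinv _) ⟨?_, ?_, ?_, ?_⟩
  · rw [hNK, Matrix.mul_add, hPW, hPdef, hP.mul_mul']
  · rw [hKN, ← Matrix.mul_assoc, ← Matrix.mul_assoc, hPB]
  · rw [hNK, hPt]
  · rw [hKN, hPt]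

end Pseudoinverse

/-! ### Gaussian laws under linear maps and quadratic-exponential tilts. -/

section GaussianMeasures

open scoped ENNReal MatrixOrder RealInnerProductSpace

/-- A matrix acting on Euclidean vectors, as a continuous linear map. -/
noncomputable def actCLM {a b : ℕ} (M : Matrix (Fin a) (Fin b) ℝ) :
    EuclideanSpace ℝ (Fin b) →L[ℝ] EuclideanSpace ℝ (Fin a) :=
  LinearMap.toContinuousLinearMap
    { toFun := act M
      map_add' := fun x y => by ext i; simp [act, Matrix.mulVec_add]
      map_smul' := fun c x => by ext i; simp [act, Matrix.mulVec_smul] }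

@[simp] lemma coe_actCLM {a b : ℕ} (M : Matrix (Fin a) (Fin b) ℝ) : ⇑(actCLM M) = act M := rfl

@[fun_prop] lemma measurable_act {a b : ℕ} (M : Matrix (Fin a) (Fin b) ℝ) : Measurable (act M) :=
  (actCLM M).measurable

lemma act_add {a b : ℕ} (M : Matrix (Fin a) (Fin b) ℝ) (x y : EuclideanSpace ℝ (Fin b)) :
    act M (x + y) = act M x + act M y := (actCLM M).map_add x y

lemma act_sub {a b : ℕ} (M : Matrix (Fin a) (Fin b) ℝ) (x y : EuclideanSpace ℝ (Fin b)) :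
    act M (x - y) = act M x - act M y := (actCLM M).map_sub x y

lemma act_act {a b c : ℕ} (M : Matrix (Fin a) (Fin b) ℝ) (N : Matrix (Fin b) (Fin c) ℝ)
    (x : EuclideanSpace ℝ (Fin c)) : act M (act N x) = act (M * N) x := by
  simp [act, Matrix.mulVec_mulVec]

@[simp] lemma act_one {a : ℕ} (x : EuclideanSpace ℝ (Fin a)) :
    act (1 : Matrix (Fin a) (Fin a) ℝ) x = x := by
  simp [act]

lemma inner_act_right {a b : ℕ} (M : Matrix (Fin a) (Fin b) ℝ) (x : EuclideanSpace ℝ (Fin b))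
    (y : EuclideanSpace ℝ (Fin a)) : ⟪act M x, y⟫ = ⟪x, act Mᵀ y⟫ := by
  simp only [act, EuclideanSpace.inner_eq_star_dotProduct, star_trivial]
  rw [dotProduct_mulVec, Matrix.mulVec_transpose]

variable {n : ℕ} {S T W : Matrix (Fin n) (Fin n) ℝ}

lemma map_act_multivariateGaussian {a : ℕ} (hS : S.PosSemidef) (M : Matrix (Fin a) (Fin n) ℝ) :
    (multivariateGaussian 0 S).map (act M) = multivariateGaussian 0 (M * S * Mᵀ) := by
  have hM : (M * S * Mᵀ).PosSemidef := by
    simpa using hS.mul_mul_conjTranspose_same M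
  have : IsProbabilityMeasure ((multivariateGaussian 0 S).map (act M)) :=
    Measure.isProbabilityMeasure_map (by fun_prop)
  refine Measure.ext_of_charFun (funext fun t => ?_)
  have h1 : charFun ((multivariateGaussian 0 S).map (act M)) t
      = charFun (multivariateGaussian 0 S) (act Mᵀ t) := by
    rw [charFun_apply, charFun_apply, integral_map (by fun_prop) (by fun_prop)]
    simp_rw [inner_act_right]
  rw [h1, charFun_multivariateGaussian hS, charFun_multivariateGaussian hM]
  simp only [act, inner_zero_right]
  congr 4
  rw [Matrix.mulVec_mulVec, Matrix.mulVec_transpose, ← Matrix.dotProduct_mulVec,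
    Matrix.mulVec_mulVec, Matrix.mul_assoc]

lemma conv_multivariateGaussian (hS : S.PosSemidef) (hT : T.PosSemidef) :
    (multivariateGaussian 0 S) ∗ (multivariateGaussian 0 T) = multivariateGaussian 0 (S + T) := by
  refine Measure.ext_of_charFun (funext fun t => ?_)
  rw [charFun_conv, charFun_multivariateGaussian hS, charFun_multivariateGaussian hT,
    charFun_multivariateGaussian (hS.add hT), ← Complex.exp_add, Matrix.add_mulVec,
    dotProduct_add]
  congr 1
  push_cast
  simp
  ring

lemma multivariateGaussian_eq_map_act :
    multivariateGaussian 0 S =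
      (stdGaussian (EuclideanSpace ℝ (Fin n))).map (act (CFC.sqrt S)) := by
  rw [multivariateGaussian]
  congr 1
  funext x
  rw [zero_add]
  rfl

lemma pi_gaussianReal_eq_withDensity :
    (Measure.pi fun _ : Fin n => gaussianReal 0 1) =
      (volume : Measure (Fin n → ℝ)).withDensity
        fun x => ENNReal.ofReal (∏ i, gaussianPDFReal 0 1 (x i)) := by
  refine Measure.pi_eq fun s hs => ?_
  rw [withDensity_apply _ (MeasurableSet.univ_pi hs), ← ofReal_integral_eq_lintegral_ofReal,
    volume_pi, Measure.restrict_pi_pi,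
    integral_fintype_prod_eq_prod (f := fun _ x => gaussianPDFReal 0 1 x),
    ENNReal.ofReal_prod_of_nonneg]
  · simp_rw [gaussianReal_apply_eq_integral 0 one_ne_zero]
  · exact fun i _ => integral_nonneg fun x => gaussianPDFReal_nonneg _ _ _
  · rw [volume_pi, Measure.restrict_pi_pi]
    exact Integrable.fintype_prod fun i => (integrable_gaussianPDFReal 0 1).restrict
  · exact ae_of_all _ fun x => Finset.prod_nonneg fun i _ => gaussianPDFReal_nonneg _ _ _

/-- The standard Gaussian measure has a density proportional to `exp (-‖x‖² / 2)`. -/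
lemma stdGaussian_eq_withDensity :
    stdGaussian (EuclideanSpace ℝ (Fin n)) =
      ENNReal.ofReal ((√(2 * Real.pi))⁻¹ ^ n) • (volume.withDensity
        fun x : EuclideanSpace ℝ (Fin n) => ENNReal.ofReal (Real.exp (-‖x‖ ^ 2 / 2))) := by
  rw [← map_pi_eq_stdGaussian, pi_gaussianReal_eq_withDensity]
  have hd : (fun x : Fin n → ℝ => ENNReal.ofReal (∏ i, gaussianPDFReal 0 1 (x i))) =
      fun x => ENNReal.ofReal ((√(2 * Real.pi))⁻¹ ^ n) *
        ENNReal.ofReal (Real.exp (-‖WithLp.toLp 2 x‖ ^ 2 / 2)) := by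
    funext x
    rw [← ENNReal.ofReal_mul (by positivity)]
    congr 1
    simp only [gaussianPDFReal_def, Finset.prod_mul_distrib, Finset.prod_const, Finset.card_univ,
      Fintype.card_fin, ← Real.exp_sum, EuclideanSpace.real_norm_sq_eq]
    simp [neg_div, Finset.sum_div]
  have hmp := PiLp.volume_preserving_toLp (Fin n)
  ext s hs
  rw [Measure.map_apply hmp.measurable hs, withDensity_apply _ (hmp.measurable hs),
    Measure.smul_apply, withDensity_apply _ hs, hd, lintegral_const_mul _ (by fun_prop),
    ← hmp.setLIntegral_comp_preimage hs (by fun_prop)]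
  rfl

lemma withDensity_map_measure {α β : Type*} [MeasurableSpace α] [MeasurableSpace β] (μ : Measure α)
    {g : α → β} {f : β → ℝ≥0∞} (hg : Measurable g) (hf : Measurable f) :
    (μ.map g).withDensity f = (μ.withDensity (f ∘ g)).map g := by
  ext s hs
  rw [withDensity_apply _ hs, Measure.map_apply hg hs, withDensity_apply _ (hg hs),
    setLIntegral_map hs hf hg]
  rfl

/-- The weight `exp (-x' W x / 2)`. -/
noncomputable def quadWeight (W : Matrix (Fin n) (Fin n) ℝ) (x : EuclideanSpace ℝ (Fin n)) :
    ℝ≥0∞ :=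
  ENNReal.ofReal (Real.exp (-(x.ofLp ⬝ᵥ W *ᵥ x.ofLp) / 2))

@[fun_prop] lemma measurable_quadWeight (W : Matrix (Fin n) (Fin n) ℝ) :
    Measurable (quadWeight W) := by
  unfold quadWeight
  have : Continuous fun x : EuclideanSpace ℝ (Fin n) => x.ofLp ⬝ᵥ W *ᵥ x.ofLp := by fun_prop
  fun_prop

lemma quadWeight_act (W : Matrix (Fin n) (Fin n) ℝ) (B : Matrix (Fin n) (Fin n) ℝ)
    (x : EuclideanSpace ℝ (Fin n)) : quadWeight W (act B x) = quadWeight (Bᵀ * W * B) x := by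
  unfold quadWeight act
  simp only
  rw [Matrix.mulVec_mulVec, Matrix.mul_assoc Bᵀ, ← Matrix.mulVec_mulVec x.ofLp Bᵀ,
    Matrix.dotProduct_mulVec x.ofLp Bᵀ, Matrix.vecMul_transpose]

lemma quadWeight_mul (W W' : Matrix (Fin n) (Fin n) ℝ) (x : EuclideanSpace ℝ (Fin n)) :
    quadWeight W x * quadWeight W' x = quadWeight (W + W') x := by
  unfold quadWeight
  rw [← ENNReal.ofReal_mul (Real.exp_pos _).le, ← Real.exp_add, Matrix.add_mulVec, dotProduct_add]
  congr 2
  ring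

lemma quadWeight_one (x : EuclideanSpace ℝ (Fin n)) :
    quadWeight 1 x = ENNReal.ofReal (Real.exp (-‖x‖ ^ 2 / 2)) := by
  rw [EuclideanSpace.real_norm_sq_eq]
  simp [quadWeight, dotProduct, sq]

lemma sqrt_spec (hS : S.PosSemidef) :
    (CFC.sqrt S)ᵀ = CFC.sqrt S ∧ CFC.sqrt S * CFC.sqrt S = S :=
  ⟨transpose_eq_of_posSemidef (Matrix.nonneg_iff_posSemidef.mp (CFC.sqrt_nonneg S)),
    CFC.sqrt_mul_sqrt_self _ hS.nonneg⟩

/-- With L = √(1 + T), the tilted density is exp (-‖x‖² / 2 - x' T x / 2) = exp (-‖L x‖² / 2), so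
the tilted law is proportional to the image of the standard Gaussian under L⁻¹. The constant is left
implicit; total mass determines it later. -/
lemma exists_withDensity_stdGaussian (hT : T.PosSemidef) :
    ∃ c : ℝ≥0∞, (stdGaussian (EuclideanSpace ℝ (Fin n))).withDensity (quadWeight T) =
      c • multivariateGaussian 0 (1 + T)⁻¹ := by
  have hJ : (1 + T).PosDef := Matrix.PosDef.one.add_posSemidef hT
  obtain ⟨hLt, hLL⟩ := sqrt_spec hJ.posSemidef
  set L := CFC.sqrt (1 + T) with hL
  have hdet : L.det ≠ 0 := by
    intro h
    have := hJ.det_pos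
    rw [← hLL, Matrix.det_mul, h, mul_zero] at this
    exact this.false
  have hLu : IsUnit L.det := hdet.isUnit
  have hLi : ∀ x, act L⁻¹ (act L x) = x := fun x => by
    rw [act_act, Matrix.nonsing_inv_mul _ hLu, act_one]
  have hmap : (volume : Measure (EuclideanSpace ℝ (Fin n))).map (act L) =
      ENNReal.ofReal |(LinearMap.det (actCLM L).toLinearMap)⁻¹| • volume := by
    refine Measure.map_linearMap_addHaar_eq_smul_addHaar (f := (actCLM L).toLinearMap) volume ?_
    refine (LinearMap.isUnit_iff_isUnit_det _).mp ?_ |>.ne_zero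
    refine (Units.mk (actCLM L).toLinearMap (actCLM L⁻¹).toLinearMap ?_ ?_).isUnit
    · refine LinearMap.ext fun x => ?_
      change act L (act L⁻¹ x) = x
      rw [act_act, Matrix.mul_nonsing_inv _ hLu, act_one]
    · exact LinearMap.ext hLi
  set d := ENNReal.ofReal |(LinearMap.det (actCLM L).toLinearMap)⁻¹|
  have hstd : stdGaussian (EuclideanSpace ℝ (Fin n)) =
      ENNReal.ofReal ((√(2 * Real.pi))⁻¹ ^ n) • (volume.withDensity (quadWeight 1)) := by
    rw [stdGaussian_eq_withDensity]
    simp_rw [← quadWeight_one]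
  have hdens : quadWeight (1 : Matrix (Fin n) (Fin n) ℝ) * quadWeight T =
      quadWeight 1 ∘ act L := by
    funext x
    rw [Pi.mul_apply, quadWeight_mul, Function.comp_apply, quadWeight_act, hLt, Matrix.mul_one,
      hLL]
  -- L scales Lebesgue measure by d, so the density composed with L becomes an image measure under
  -- L⁻¹.
  have hkey : volume.withDensity (quadWeight 1 ∘ act L) =
      d • (volume.withDensity (quadWeight 1)).map (act L⁻¹) := by
    rw [← Measure.map_smul, ← withDensity_smul_measure, ← hmap,
      withDensity_map_measure _ (by fun_prop) (by fun_prop),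
      Measure.map_map (by fun_prop) (by fun_prop), show act L⁻¹ ∘ act L = id from funext hLi,
      Measure.map_id]
  refine ⟨d, ?_⟩
  have hinv : L⁻¹ * 1 * (L⁻¹)ᵀ = (1 + T)⁻¹ := by
    rw [Matrix.transpose_nonsing_inv, hLt, Matrix.mul_one, ← Matrix.mul_inv_rev, hLL]
  rw [← hinv, ← map_act_multivariateGaussian Matrix.PosSemidef.one, multivariateGaussian_zero_one,
    hstd, withDensity_smul_measure, ← withDensity_mul _ (by fun_prop) (by fun_prop), hdens, hkey,
    Measure.map_smul, smul_comm]

/-- Weighting the centred Gaussian law with covariance `S` by `exp (-x' W x / 2)` gives, up to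
a constant, the centred Gaussian law with covariance `(W + S⁺)⁺`, provided `S ⪰ (W + S⁺)⁺`. -/
lemma exists_withDensity_multivariateGaussian (hS : S.PosSemidef) (hW : W.PosSemidef)
    (h : (S - pinv (W + pinv S)).PosSemidef) :
    ∃ c : ℝ≥0∞, (multivariateGaussian 0 S).withDensity (quadWeight W) =
      c • multivariateGaussian 0 (pinv (W + pinv S)) := by
  obtain ⟨hBt, hBB⟩ := sqrt_spec hS
  have hT : (CFC.sqrt S * W * CFC.sqrt S).PosSemidef := by
    have := hW.mul_mul_conjTranspose_same (CFC.sqrt S)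
    rwa [Matrix.conjTranspose_eq_transpose_of_trivial, hBt] at this
  obtain ⟨c, hc⟩ := exists_withDensity_stdGaussian hT
  refine ⟨c, ?_⟩
  -- Pulling back along B = √S moves the tilt to the standard Gaussian, which has a density even
  -- when N(0, S) has none.
  have hcomp : quadWeight W ∘ act (CFC.sqrt S) = quadWeight (CFC.sqrt S * W * CFC.sqrt S) := by
    funext x
    rw [Function.comp_apply, quadWeight_act, hBt]
  have hJ := (Matrix.PosDef.one.add_posSemidef hT).inv.posSemidef
  rw [pinv_add_pinv_eq hBt hBB hW (mul_pinv_mul_self_of_posSemidef_sub hS hW h),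
    multivariateGaussian_eq_map_act, withDensity_map_measure _ (by fun_prop) (by fun_prop), hcomp,
    hc, Measure.map_smul, map_act_multivariateGaussian hJ, hBt]

end GaussianMeasures

/-! ### Conditional laws and independence via restricted measures. -/

section ConditionalLaws

open scoped ENNReal

variable {Ω E : Type*} {m mΩ : MeasurableSpace Ω} [MeasurableSpace E] {μ : Measure Ω}

/-- Adjoining a function which is constant on `D` does not change the trace of a σ-algebra
on `D`. -/
lemma exists_inter_eq_of_measurableSet_sup_comap {m : MeasurableSpace Ω} {D : Set Ω} {f : Ω → E}
    {c : E} (hf : ∀ ω ∈ D, f ω = c) {s : Set Ω}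
    (hs : MeasurableSet[m ⊔ MeasurableSpace.comap f inferInstance] s) :
    ∃ F, MeasurableSet[m] F ∧ s ∩ D = F ∩ D := by
  -- The sets whose trace on D is the trace of an m-measurable set form a σ-algebra, so only the
  -- generators need checking.
  let m' : MeasurableSpace Ω :=
    { MeasurableSet' := fun s => ∃ F, MeasurableSet[m] F ∧ s ∩ D = F ∩ D
      measurableSet_empty := ⟨∅, @MeasurableSet.empty _ m, rfl⟩
      measurableSet_compl := by
        rintro s ⟨F, hF, h⟩
        refine ⟨Fᶜ, hF.compl, ?_⟩
        ext ω
        have := Set.ext_iff.mp h ω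
        simp only [Set.mem_inter_iff, Set.mem_compl_iff] at this ⊢
        tauto
      measurableSet_iUnion := by
        intro s hs
        choose F hF h using hs
        refine ⟨⋃ i, F i, MeasurableSet.iUnion hF, ?_⟩
        rw [Set.iUnion_inter, Set.iUnion_inter]
        exact Set.iUnion_congr h }
  have hle : m ⊔ MeasurableSpace.comap f inferInstance ≤ m' := by
    refine sup_le (fun s hs => ⟨s, hs, rfl⟩) ?_
    rintro _ ⟨B, -, rfl⟩
    by_cases hc : c ∈ B
    · refine ⟨Set.univ, MeasurableSet.univ, ?_⟩
      ext ω
      simp only [Set.mem_inter_iff, Set.mem_preimage, Set.mem_univ, true_and, and_iff_right_iff_imp]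
      intro h
      rwa [hf ω h]
    · refine ⟨∅, @MeasurableSet.empty _ m, ?_⟩
      ext ω
      simp only [Set.mem_inter_iff, Set.mem_preimage, Set.mem_empty_iff_false, false_and, iff_false,
        not_and]
      intro h hω
      rw [hf ω hω] at h
      exact hc h
  exact hle s hs

/-- If on each fibre of an `m`-measurable integer `τ` the variable `X` is independent of `m` with
law `κ τ`, then `κ ∘ τ` is the conditional law of `X` given `m`. -/
lemma hasCondLaw_of_fibers [IsFiniteMeasure μ] {X : Ω → E} (hX : Measurable X) (hm : m ≤ mΩ)
    {τ : Ω → ℕ} (hτ : Measurable[m] τ) (κ : ℕ → Measure E) [∀ t, IsProbabilityMeasure (κ t)]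
    (h : ∀ s, MeasurableSet[m] s → ∀ t,
      (μ.restrict (s ∩ τ ⁻¹' {t})).map X = μ (s ∩ τ ⁻¹' {t}) • κ t) :
    HasCondLaw μ X m (fun ω => κ (τ ω)) := by
  intro B hB
  have hmeas : Measurable[m] fun ω => κ (τ ω) B :=
    (Measurable.of_discrete (f := fun t => κ t B)).comp hτ
  have hmeas' : Measurable[m] fun ω => (κ (τ ω)).real B :=
    (Measurable.of_discrete (f := fun t => (κ t).real B)).comp hτ
  refine ⟨hmeas, ?_⟩
  have hτ' : Measurable τ := hτ.mono hm le_rfl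
  have hint : Integrable (fun ω => (κ (τ ω)).real B) μ := by
    refine Integrable.of_bound (hmeas'.mono hm le_rfl).aestronglyMeasurable 1 (ae_of_all _ fun ω => ?_)
    rw [Real.norm_of_nonneg measureReal_nonneg]
    exact measureReal_le_one
  refine (ae_eq_condExp_of_forall_setIntegral_eq hm ((integrable_const 1).indicator (hX hB))
    (fun s _ _ => hint.integrableOn) (fun s hs _ => ?_) hmeas'.aestronglyMeasurable).symm
  have hs' := hm s hs
  rw [integral_indicator_const _ (hX hB), smul_eq_mul, mul_one, measureReal_restrict_apply (hX hB)]
  simp only [measureReal_def]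
  rw [integral_toReal (hmeas.mono hm le_rfl).aemeasurable
    (ae_of_all _ fun ω => measure_lt_top _ _)]
  congr 1
  -- Both sides are sums over the countably many fibres of τ, where the hypothesis gives equality
  -- term by term.
  have h1 : ∫⁻ ω in s, κ (τ ω) B ∂μ = ∑' t, κ t B * μ (s ∩ τ ⁻¹' {t}) := by
    rw [← lintegral_map (f := fun t => κ t B) Measurable.of_discrete hτ', lintegral_countable']
    refine tsum_congr fun t => ?_
    rw [Measure.map_apply hτ' (measurableSet_singleton t),
      Measure.restrict_apply (hτ' (measurableSet_singleton t)), Set.inter_comm]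
  have h2 : μ (X ⁻¹' B ∩ s) = ∑' t, μ (X ⁻¹' B ∩ s ∩ τ ⁻¹' {t}) := by
    have : μ (X ⁻¹' B ∩ s) = ∫⁻ _, 1 ∂(μ.restrict (X ⁻¹' B ∩ s)).map τ := by
      rw [lintegral_one, Measure.map_apply hτ' MeasurableSet.univ]
      simp
    rw [this, lintegral_countable']
    refine tsum_congr fun t => ?_
    rw [Measure.map_apply hτ' (measurableSet_singleton t),
      Measure.restrict_apply (hτ' (measurableSet_singleton t)), Set.inter_comm, one_mul]
  rw [h1, h2]
  refine tsum_congr fun t => ?_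
  have := congrArg (fun ν => ν B) (h s hs t)
  simp only [Measure.smul_apply, smul_eq_mul] at this
  rw [Measure.map_apply hX hB, Measure.restrict_apply (hX hB)] at this
  rw [mul_comm, ← this, Set.inter_assoc]

/-- Translates a real-valued conditional probability into an `ℝ≥0∞`-valued integral identity, the
form in which the channel law is used as a density. -/
lemma measure_inter_eq_setLIntegral [IsFiniteMeasure μ] (hm : m ≤ mΩ) {D : Set Ω}
    (hD : MeasurableSet D) {g : Ω → ℝ} (hg : ∀ ω, 0 ≤ g ω)
    (h : μ[D.indicator (fun _ => (1 : ℝ)) | m] =ᵐ[μ] g) {F : Set Ω} (hF : MeasurableSet[m] F) :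
    μ (F ∩ D) = ∫⁻ ω in F, ENNReal.ofReal (g ω) ∂μ := by
  have hint : Integrable g μ := integrable_condExp.congr h
  rw [← ofReal_integral_eq_lintegral_ofReal hint.integrableOn (ae_of_all _ hg),
    ← setIntegral_congr_ae (g := g) (hm F hF) (h.mono fun _ h _ => h),
    setIntegral_condExp hm ((integrable_const 1).indicator hD) hF,
    integral_indicator_const _ hD, smul_eq_mul, mul_one, measureReal_restrict_apply hD,
    ofReal_measureReal, Set.inter_comm]

/-- If `D` has conditional probability `f (X)` given `m` on the event `F ∈ m`, where `X` is
`m`-measurable, then the law of `X` on `F ∩ D` has density `f` with respect to its law on `F`. -/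
lemma map_restrict_inter_eq_withDensity (hm : m ≤ mΩ) {X : Ω → E} (hX : Measurable[m] X)
    {D F : Set Ω} (hF : MeasurableSet[m] F) {G : Ω → ℝ≥0∞} {f : E → ℝ≥0∞}
    (hf : Measurable f) (h : ∀ F', MeasurableSet[m] F' → μ (F' ∩ D) = ∫⁻ ω in F', G ω ∂μ)
    (hG : ∀ ω ∈ F, G ω = f (X ω)) :
    (μ.restrict (F ∩ D)).map X = ((μ.restrict F).map X).withDensity f := by
  have hX' : Measurable X := hX.mono hm le_rfl
  ext B hB
  rw [Measure.map_apply hX' hB, Measure.restrict_apply (hX' hB), withDensity_apply _ hB,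
    setLIntegral_map hB hf hX', Measure.restrict_restrict (hX' hB), ← Set.inter_assoc,
    h _ ((hX hB).inter hF)]
  exact setLIntegral_congr_fun (hm _ ((hX hB).inter hF)) fun ω hω => hG ω hω.2

/-- The joint law, on an event of `m`, of an `m`-measurable variable and a variable which is
independent of `m`. -/
lemma map_restrict_prodMk_of_indep {E' : Type*} [MeasurableSpace E'] [IsFiniteMeasure μ]
    (hm : m ≤ mΩ) {X : Ω → E} (hX : Measurable[m] X) {Y : Ω → E'} (hY : Measurable Y)
    (h : Indep m (MeasurableSpace.comap Y inferInstance) μ) {F : Set Ω}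
    (hF : MeasurableSet[m] F) :
    (μ.restrict F).map (fun ω => (X ω, Y ω)) = ((μ.restrict F).map X).prod (μ.map Y) := by
  have hX' : Measurable X := hX.mono hm le_rfl
  refine (Measure.prod_eq fun B C hB hC => ?_).symm
  rw [Measure.map_apply (hX'.prodMk hY) (hB.prod hC), Measure.map_apply hX' hB,
    Measure.map_apply hY hC, Measure.restrict_apply (hX' hB),
    Measure.restrict_apply ((hX'.prodMk hY) (hB.prod hC)),
    ← (Indep_iff _ _ _).mp h _ _ ((hX hB).inter hF) ⟨C, hC, rfl⟩]
  congr 1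
  ext ω
  simp only [Set.mem_inter_iff, Set.mem_preimage, Set.mem_prod]
  tauto

/-- If an event `D` has an `m`-measurable conditional probability given the larger σ-algebra
`m ⊔ σ(Y)`, and `Y` is independent of `m`, then `Y` is independent of `m ⊔ σ(1_D)`. -/
lemma indep_sup_comap_of_condProb {E' : Type*} [MeasurableSpace E'] [IsProbabilityMeasure μ]
    (hm : m ≤ mΩ) {Y : Ω → E'} (hY : Measurable Y)
    (h : Indep m (MeasurableSpace.comap Y inferInstance) μ) {γ : Ω → ℝ} (hγ : Measurable γ)
    (hγ01 : ∀ ω, γ ω = 0 ∨ γ ω = 1) {G : Ω → ℝ≥0∞} (hGm : Measurable[m] G)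
    (hG : ∀ F', MeasurableSet[m ⊔ MeasurableSpace.comap Y inferInstance] F' →
      μ (F' ∩ γ ⁻¹' {0}) = ∫⁻ ω in F', G ω ∂μ) :
    Indep (m ⊔ MeasurableSpace.comap γ inferInstance)
      (MeasurableSpace.comap Y inferInstance) μ := by
  have h0 : MeasurableSet (γ ⁻¹' {0}) := hγ (measurableSet_singleton 0)
  have key : ∀ F C, MeasurableSet[m] F → MeasurableSet C →
      μ (F ∩ γ ⁻¹' {0} ∩ Y ⁻¹' C) = μ (F ∩ γ ⁻¹' {0}) * μ (Y ⁻¹' C) := by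
    intro F C hF hC
    have hF1 : MeasurableSet[m ⊔ MeasurableSpace.comap Y inferInstance] F :=
      (le_sup_left : m ≤ m ⊔ MeasurableSpace.comap Y inferInstance) _ hF
    have hC1 : MeasurableSet[m ⊔ MeasurableSpace.comap Y inferInstance] (Y ⁻¹' C) :=
      (le_sup_right : MeasurableSpace.comap Y inferInstance ≤ _) _ ⟨C, hC, rfl⟩
    rw [Set.inter_right_comm, hG _ (hF1.inter hC1), hG _ hF1,
      ← lintegral_indicator (hm _ hF), ← lintegral_indicator ((hm _ hF).inter (hY hC))]
    -- The weight G is m-measurable, so the integrand splits into an m-measurable factor and a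
    -- function of Y.
    have hind : (F ∩ Y ⁻¹' C).indicator G =
        fun ω => F.indicator G ω * (Y ⁻¹' C).indicator (fun _ => (1 : ℝ≥0∞)) ω := by
      funext ω
      by_cases h1 : ω ∈ F <;> by_cases h2 : ω ∈ Y ⁻¹' C <;> simp [h1, h2]
    rw [hind, lintegral_mul_eq_lintegral_mul_lintegral_of_independent_measurableSpace hm
      hY.comap_le h (hGm.indicator hF)
      (Measurable.indicator measurable_const ⟨C, hC, rfl⟩), lintegral_indicator_const (hY hC), one_mul]
  -- The event γ = 1 is handled by subtracting the case γ = 0 from the independence of Y and m.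
  have key1 : ∀ F C, MeasurableSet[m] F → MeasurableSet C →
      μ (F ∩ γ ⁻¹' {1} ∩ Y ⁻¹' C) = μ (F ∩ γ ⁻¹' {1}) * μ (Y ⁻¹' C) := by
    intro F C hF hC
    have hdiff : ∀ H : Set Ω, H ∩ γ ⁻¹' {1} = H \ (H ∩ γ ⁻¹' {0}) := by
      intro H
      ext ω
      rcases hγ01 ω with h | h <;> simp [h]
    rw [Set.inter_right_comm, hdiff, hdiff,
      measure_sdiff Set.inter_subset_left
        (((hm _ hF).inter (hY hC)).inter h0).nullMeasurableSet (measure_ne_top _ _),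
      measure_sdiff Set.inter_subset_left ((hm _ hF).inter h0).nullMeasurableSet
        (measure_ne_top _ _), Set.inter_right_comm, key F C hF hC,
      (Indep_iff _ _ _).mp h _ _ hF ⟨C, hC, rfl⟩, ENNReal.sub_mul fun _ _ => measure_ne_top _ _]
  rw [Indep_iff]
  rintro s _ hs ⟨C, hC, rfl⟩
  -- On each of the events γ = 0 and γ = 1 the set s agrees with some m-measurable set.
  obtain ⟨F0, hF0, e0⟩ := exists_inter_eq_of_measurableSet_sup_comap
    (D := γ ⁻¹' {0}) (c := (0 : ℝ)) (fun ω h => h) hs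
  obtain ⟨F1, hF1, e1⟩ := exists_inter_eq_of_measurableSet_sup_comap
    (D := γ ⁻¹' {1}) (c := (1 : ℝ)) (fun ω h => h) hs
  have hsplit : ∀ H : Set Ω, μ H = μ (H ∩ γ ⁻¹' {0}) + μ (H ∩ γ ⁻¹' {1}) := by
    intro H
    rw [← measure_inter_add_sdiff H h0]
    congr 2
    ext ω
    rcases hγ01 ω with h | h <;> simp [h]
  rw [hsplit (s ∩ Y ⁻¹' C), hsplit s, Set.inter_right_comm, e0, key F0 C hF0 hC,
    Set.inter_right_comm s, e1, key1 F1 C hF1 hC, add_mul]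

lemma iSup_Icc_add_one {α : Type*} [CompleteLattice α] (f : ℕ → α) (k : ℕ) :
    ⨆ t ∈ Finset.Icc 1 (k + 1), f t = (⨆ t ∈ Finset.Icc 1 k, f t) ⊔ f (k + 1) := by
  rw [← Finset.insert_Icc_right_eq_Icc_add_one (by omega), Finset.iSup_insert, sup_comm]

end ConditionalLaws

/-! ### Linear regression for Gaussian vectors. -/

section Regression

open scoped ENNReal RealInnerProductSpace

variable {Ω F G : Type*} [mΩ : MeasurableSpace Ω] {μ : Measure Ω}
  [NormedAddCommGroup G] [InnerProductSpace ℝ G] [FiniteDimensional ℝ G] {n : ℕ}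

/-- Least squares: a square-integrable `X` has a linear predictor in terms of `Y` whose error is
orthogonal to all linear functions of `Y`. -/
lemma exists_inner_orthogonal_error {X : Ω → ℝ} {Y : Ω → G} (hX : MemLp X 2 μ)
    (hY : MemLp Y 2 μ) : ∃ y₀ : G, ∀ y, ∫ ω, (X ω - ⟪y₀, Y ω⟫) * ⟪y, Y ω⟫ ∂μ = 0 := by
  have hm : ∀ y : G, MemLp (fun ω => ⟪y, Y ω⟫) 2 μ := fun y => hY.const_inner y
  -- The predictor is the L² projection onto the range of T, which exists because that range is
  -- finite-dimensional.
  let T : G →ₗ[ℝ] Lp ℝ 2 μ :=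
    { toFun := fun y => (hm y).toLp _
      map_add' := fun y z => by
        rw [← MemLp.toLp_add]
        simp only [inner_add_left]
        rfl
      map_smul' := fun c y => by
        rw [RingHom.id_apply, ← MemLp.toLp_const_smul]
        simp only [real_inner_smul_left]
        rfl }
  obtain ⟨y₀, hy₀⟩ : ∃ y₀, T y₀ = (LinearMap.range T).starProjection (hX.toLp X) :=
    Submodule.starProjection_apply_mem (LinearMap.range T) (hX.toLp X)
  refine ⟨y₀, fun y => ?_⟩
  have h := Submodule.starProjection_inner_eq_zero (K := LinearMap.range T) (hX.toLp X) (T y)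
    ⟨y, rfl⟩
  rw [← hy₀, L2.inner_def] at h
  rw [← h]
  refine integral_congr_ae ?_
  filter_upwards [Lp.coeFn_sub (hX.toLp X) (T y₀), hX.coeFn_toLp, (hm y₀).coeFn_toLp,
    (hm y).coeFn_toLp] with ω h1 h2 h3 h4
  have h3' : (T y₀ : Ω → ℝ) ω = ⟪y₀, Y ω⟫ := h3
  have h4' : (T y : Ω → ℝ) ω = ⟪y, Y ω⟫ := h4
  rw [h1, Pi.sub_apply, h2, h3', h4', RCLike.inner_apply, conj_trivial, mul_comm]

variable [IsProbabilityMeasure μ] [NormedAddCommGroup F] [NormedSpace ℝ F] [MeasurableSpace F]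
  [BorelSpace F] [SecondCountableTopology F] [CompleteSpace F] [MeasurableSpace G] [BorelSpace G]

lemma inner_eq_sum_mul (x y : EuclideanSpace ℝ (Fin n)) : ⟪x, y⟫ = ∑ i, x i * y i := by
  simp [PiLp.inner_apply, mul_comm]

/-- Regression for a centred Gaussian vector `Z`: given a linear function `K Z`, a linear function
`L Z` is the sum of a linear function of `K Z`, which is its conditional expectation, and an
independent error. -/
lemma exists_gaussian_regression {Z : Ω → F} (hZm : Measurable Z) (hZ : HasGaussianLaw Z μ)
    (hZ0 : ∫ ω, Z ω ∂μ = 0) (L : F →L[ℝ] EuclideanSpace ℝ (Fin n)) (K : F →L[ℝ] G) :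
    ∃ M : G →L[ℝ] EuclideanSpace ℝ (Fin n),
      IndepFun (fun ω => L (Z ω) - M (K (Z ω))) (fun ω => K (Z ω)) μ ∧
      μ[fun ω => L (Z ω) | MeasurableSpace.comap (fun ω => K (Z ω)) inferInstance]
        =ᵐ[μ] fun ω => M (K (Z ω)) := by
  have hKL : ∀ {H : Type _} [NormedAddCommGroup H] [NormedSpace ℝ H] [CompleteSpace H]
      (J : F →L[ℝ] H), ∫ ω, J (Z ω) ∂μ = 0 := fun J => by
    rw [J.integral_comp_comm hZ.integrable, hZ0, map_zero]
  have hL2 : MemLp (fun ω => L (Z ω)) 2 μ := (hZ.map_fun L).memLp_two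
  have hK2 : MemLp (fun ω => K (Z ω)) 2 μ := (hZ.map_fun K).memLp_two
  have hLi : ∀ i, MemLp (fun ω => L (Z ω) i) 2 μ := fun i =>
    ((hZ.map_fun L).map_fun (EuclideanSpace.proj (𝕜 := ℝ) i)).memLp_two
  choose y hy using fun i => exists_inner_orthogonal_error (hLi i) hK2
  let M : G →L[ℝ] EuclideanSpace ℝ (Fin n) :=
    ((PiLp.continuousLinearEquiv 2 ℝ fun _ : Fin n => ℝ).symm : _ →L[ℝ] _) ∘L
      ContinuousLinearMap.pi fun i => innerSL ℝ (y i)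
  have hM : ∀ g i, M g i = ⟪y i, g⟫ := fun g i => rfl
  -- The error and K Z are jointly Gaussian, and least squares makes them uncorrelated.
  have hind : IndepFun (fun ω => L (Z ω) - M (K (Z ω))) (fun ω => K (Z ω)) μ := by
    refine HasGaussianLaw.indepFun_of_covariance_inner
      (hZ.map_fun ((L - M ∘L K).prod K)) fun x z => ?_
    have hr : ∀ i, MemLp (fun ω => L (Z ω) i - ⟪y i, K (Z ω)⟫) 2 μ := fun i =>
      (hLi i).sub (hK2.const_inner _)
    have hz : MemLp (fun ω => ⟪z, K (Z ω)⟫) 2 μ := hK2.const_inner _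
    simp_rw [inner_eq_sum_mul x, PiLp.sub_apply, hM]
    rw [covariance_fun_sum_left (fun i => (hr i).const_mul (x i)) hz]
    refine Finset.sum_eq_zero fun i _ => ?_
    rw [covariance_const_mul_left, covariance_eq_sub (hr i) hz]
    have h1 : μ[fun ω => ⟪z, K (Z ω)⟫] = 0 := hKL ((innerSL ℝ z) ∘L K)
    have h2 : μ[(fun ω => L (Z ω) i - ⟪y i, K (Z ω)⟫) * fun ω => ⟪z, K (Z ω)⟫] = 0 := hy i z
    rw [h1, h2]
    ring
  refine ⟨M, hind, ?_⟩
  have hKm : Measurable fun ω => K (Z ω) := K.measurable.comp hZm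
  have hLm : Measurable fun ω => L (Z ω) := L.measurable.comp hZm
  have hMKi : Integrable (fun ω => M (K (Z ω))) μ := (hZ.map_fun (M ∘L K)).integrable
  have hRi : Integrable (fun ω => L (Z ω) - M (K (Z ω))) μ := (hZ.map_fun (L - M ∘L K)).integrable
  have hRm : Measurable fun ω => L (Z ω) - M (K (Z ω)) := hLm.sub (M.measurable.comp hKm)
  have hR0 : ∫ ω, (L (Z ω) - M (K (Z ω))) ∂μ = 0 := hKL (L - M ∘L K)
  have hsum : (fun ω => L (Z ω)) =
      (fun ω => L (Z ω) - M (K (Z ω))) + fun ω => M (K (Z ω)) := by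
    funext ω
    simp
  have hR := condExp_indep_eq hRm.comap_le hKm.comap_le
    (comap_measurable fun ω => L (Z ω) - M (K (Z ω))).stronglyMeasurable hind
  rw [hR0] at hR
  have hMK : StronglyMeasurable[MeasurableSpace.comap (fun ω => K (Z ω)) inferInstance]
      fun ω => M (K (Z ω)) :=
    (M.measurable.comp (comap_measurable fun ω => K (Z ω))).stronglyMeasurable
  have hM' := condExp_of_stronglyMeasurable hKm.comap_le hMK hMKi
  rw [hsum]
  filter_upwards [condExp_add hRi hMKi (MeasurableSpace.comap (fun ω => K (Z ω)) inferInstance),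
    hR] with ω h1 h2
  rw [h1, Pi.add_apply, h2, zero_add, hM']

/-- A centred Gaussian vector with covariance form `S` has law `N(0, S)`. -/
lemma map_eq_multivariateGaussian {X : Ω → EuclideanSpace ℝ (Fin n)} (hX : HasGaussianLaw X μ)
    (h0 : ∫ ω, X ω ∂μ = 0) {S : Matrix (Fin n) (Fin n) ℝ} (hSt : Sᵀ = S)
    (hS : ∀ a b : EuclideanSpace ℝ (Fin n),
      cov[fun ω => ⟪a, X ω⟫, fun ω => ⟪b, X ω⟫; μ] = ⟪a, act S b⟫) :
    S.PosSemidef ∧ μ.map X = multivariateGaussian 0 S := by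
  have hpos : S.PosSemidef := by
    refine Matrix.PosSemidef.of_dotProduct_mulVec_nonneg
      (by rw [Matrix.IsHermitian, Matrix.conjTranspose_eq_transpose_of_trivial, hSt]) fun x => ?_
    have h1 := hS (WithLp.toLp 2 x) (WithLp.toLp 2 x)
    have hae : AEMeasurable (fun ω => ⟪WithLp.toLp 2 x, X ω⟫) μ :=
      (measurable_const.inner measurable_id).comp_aemeasurable hX.aemeasurable
    rw [covariance_self hae] at h1
    have h2 : star x ⬝ᵥ S *ᵥ x = ⟪WithLp.toLp 2 x, act S (WithLp.toLp 2 x)⟫ := by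
      rw [EuclideanSpace.inner_eq_star_dotProduct, dotProduct_comm]
      rfl
    rw [h2, ← h1]
    exact variance_nonneg _ _
  refine ⟨hpos, ?_⟩
  have := hX.isGaussian_map
  refine IsGaussian.ext ?_ ?_
  · simp only [id_eq, integral_id_multivariateGaussian]
    rw [integral_map hX.aemeasurable (by fun_prop), h0]
  · ext a b
    rw [covarianceBilin_multivariateGaussian hpos, covarianceBilin_apply_eq_cov
      IsGaussian.memLp_two_id, covariance_map_fun (by fun_prop) (by fun_prop) hX.aemeasurable, hS,
      EuclideanSpace.inner_eq_star_dotProduct, dotProduct_comm]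
    rfl

end Regression

/-! ### Gaussianity of the sensor's filter. -/

section LocalFilter

open scoped ENNReal RealInnerProductSpace

variable {n m : ℕ} {Ω : Type*} {p : Parameters n m} {s : Signals n m Ω}

/-- The initial state and the noises before time `N`. -/
def stack (s : Signals n m Ω) (N : ℕ) (ω : Ω) : EuclideanSpace ℝ (Fin n) ×
    (Fin N → EuclideanSpace ℝ (Fin n)) × (Fin N → EuclideanSpace ℝ (Fin m)) :=
  (s.x0 ω, (fun j => s.w j ω), fun j => s.v j ω)

/-- `X` is a linear function of the initial state and of the noises before time `N`. -/
def IsStackLinear {E : Type*} [NormedAddCommGroup E] [NormedSpace ℝ E] (s : Signals n m Ω) (N : ℕ)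
    (X : Ω → E) : Prop :=
  ∃ L : (EuclideanSpace ℝ (Fin n) × (Fin N → EuclideanSpace ℝ (Fin n)) ×
    (Fin N → EuclideanSpace ℝ (Fin m))) →L[ℝ] E, ∀ ω, X ω = L (stack s N ω)

lemma isStackLinear_w {k N : ℕ} (hk : k < N) : IsStackLinear s N (s.w k) :=
  ⟨ContinuousLinearMap.proj (R := ℝ) ⟨k, hk⟩ ∘L ContinuousLinearMap.fst ℝ _ _ ∘L
      ContinuousLinearMap.snd ℝ _ _, fun _ => rfl⟩

lemma isStackLinear_v {k N : ℕ} (hk : k < N) : IsStackLinear s N (s.v k) :=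
  ⟨ContinuousLinearMap.proj (R := ℝ) ⟨k, hk⟩ ∘L ContinuousLinearMap.snd ℝ _ _ ∘L
      ContinuousLinearMap.snd ℝ _ _, fun _ => rfl⟩

lemma isStackLinear_state {k N : ℕ} (hk : k ≤ N) : IsStackLinear s N (state p s k) := by
  induction k with
  | zero => exact ⟨ContinuousLinearMap.fst ℝ _ _, fun _ => rfl⟩
  | succ k ih =>
    obtain ⟨L, hL⟩ := ih (by omega)
    obtain ⟨L', hL'⟩ := isStackLinear_w (s := s) (show k < N by omega)
    exact ⟨actCLM p.A ∘L L + L', fun ω => by simp [state, hL, hL']⟩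

lemma isStackLinear_meas {k N : ℕ} (hk : k < N) : IsStackLinear s N (meas p s k) := by
  obtain ⟨L, hL⟩ := isStackLinear_state (p := p) (s := s) hk.le
  obtain ⟨L', hL'⟩ := isStackLinear_v (s := s) hk
  exact ⟨actCLM p.C ∘L L + L', fun ω => by simp [meas, hL, hL']⟩

/-- The vector of measurements `(y_1, …, y_k)`. -/
def measVec (p : Parameters n m) (s : Signals n m Ω) (k : ℕ) (ω : Ω) :
    PiLp 2 fun _ : Finset.Icc 1 k => EuclideanSpace ℝ (Fin m) :=
  WithLp.toLp 2 fun t => meas p s t ω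

lemma isStackLinear_measVec {k N : ℕ} (hk : k < N) : IsStackLinear s N (measVec p s k) := by
  choose L hL using fun t : Finset.Icc 1 k =>
    isStackLinear_meas (p := p) (s := s) (lt_of_le_of_lt (Finset.mem_Icc.mp t.2).2 hk)
  refine ⟨((PiLp.continuousLinearEquiv 2 ℝ
    fun _ : Finset.Icc 1 k => EuclideanSpace ℝ (Fin m)).symm : _ →L[ℝ] _) ∘L
      ContinuousLinearMap.pi L, fun ω => ?_⟩
  ext t
  simp [measVec, hL]

/-- Makes the sensor's σ-algebra that of one Gaussian vector, so that the regression lemma computes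
the local estimate. -/
lemma sensorInfo_eq_comap (k : ℕ) :
    sensorInfo p s k = MeasurableSpace.comap (measVec p s k) inferInstance := by
  refine le_antisymm (iSup₂_le fun t ht => ?_) ?_
  · have : meas p s t = (fun x => x ⟨t, ht⟩) ∘ measVec p s k := rfl
    rw [this, ← MeasurableSpace.comap_comp]
    refine MeasurableSpace.comap_mono (Measurable.comap_le ?_)
    fun_prop
  · refine Measurable.comap_le (m₁ := sensorInfo p s k) ?_
    refine (WithLp.measurable_toLp 2 _).comp ((@measurable_pi_iff _ _ _ (sensorInfo p s k) _ _).mpr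
      fun t => ?_)
    exact (comap_measurable (meas p s t)).mono
      (le_iSup₂_of_le (f := fun t (_ : t ∈ Finset.Icc 1 k) =>
        MeasurableSpace.comap (meas p s t) inferInstance) t.1 t.2 le_rfl) le_rfl

lemma IsStackLinear.prodMk {E E' : Type*} [NormedAddCommGroup E] [NormedSpace ℝ E]
    [NormedAddCommGroup E'] [NormedSpace ℝ E'] {N : ℕ} {X : Ω → E} {Y : Ω → E'}
    (hX : IsStackLinear s N X) (hY : IsStackLinear s N Y) :
    IsStackLinear s N fun ω => (X ω, Y ω) := by
  obtain ⟨L, hL⟩ := hX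
  obtain ⟨L', hL'⟩ := hY
  exact ⟨L.prod L', fun ω => by simp [hL, hL']⟩

lemma sensorInfo_mono : Monotone (sensorInfo p s) := fun _ _ h =>
  biSup_mono fun _ ht => Finset.Icc_subset_Icc_right h ht

variable [mΩ : MeasurableSpace Ω] {μ : Measure Ω}

lemma measurable_stack (hl : ClosedLoop p s μ) (N : ℕ) : Measurable (stack s N) :=
  hl.measurable_x0.prodMk ((measurable_pi_lambda _ fun j : Fin N => hl.measurable_w j).prodMk
    (measurable_pi_lambda _ fun j : Fin N => hl.measurable_v j))

lemma hasGaussianLaw_of_map_eq {X : Ω → EuclideanSpace ℝ (Fin n)}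
    {S : Matrix (Fin n) (Fin n) ℝ} (h : μ.map X = multivariateGaussian 0 S) :
    HasGaussianLaw X μ := ⟨by rw [h]; infer_instance⟩

lemma integral_eq_zero_of_map_eq {X : Ω → EuclideanSpace ℝ (Fin n)} (hX : Measurable X)
    {S : Matrix (Fin n) (Fin n) ℝ} (h : μ.map X = multivariateGaussian 0 S) :
    ∫ ω, X ω ∂μ = 0 := by
  have := integral_id_multivariateGaussian (μ := (0 : EuclideanSpace ℝ (Fin n))) (S := S)
  rwa [← h, integral_map hX.aemeasurable (by fun_prop)] at this

lemma hasGaussianLaw_stack (hl : ClosedLoop p s μ) (N : ℕ) : HasGaussianLaw (stack s N) μ := by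
  have hw : HasGaussianLaw (fun ω (j : Fin N) => s.w j ω) μ :=
    (hl.indep_w.precomp Fin.val_injective).hasGaussianLaw
      fun j => hasGaussianLaw_of_map_eq (hl.law_w j)
  have hv : HasGaussianLaw (fun ω (j : Fin N) => s.v j ω) μ :=
    (hl.indep_v.precomp Fin.val_injective).hasGaussianLaw
      fun j => hasGaussianLaw_of_map_eq (hl.law_v j)
  have hwv : IndepFun (fun ω (j : Fin N) => s.w j ω) (fun ω (j : Fin N) => s.v j ω) μ :=
    hl.indep_w_v.comp (φ := fun (x : ℕ → EuclideanSpace ℝ (Fin n)) (j : Fin N) => x j)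
      (ψ := fun (x : ℕ → EuclideanSpace ℝ (Fin m)) (j : Fin N) => x j)
      (by fun_prop) (by fun_prop)
  have hx : IndepFun s.x0 (fun ω => ((fun j : Fin N => s.w j ω), fun j : Fin N => s.v j ω)) μ :=
    hl.indep_x0.comp (φ := id) (ψ := fun x :
      (ℕ → EuclideanSpace ℝ (Fin n)) × (ℕ → EuclideanSpace ℝ (Fin m)) =>
        ((fun j : Fin N => x.1 j), fun j : Fin N => x.2 j))
      measurable_id (by fun_prop)
  exact hx.hasGaussianLaw (hasGaussianLaw_of_map_eq hl.law_x0) (hwv.hasGaussianLaw hw hv)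

lemma integral_stack (hl : ClosedLoop p s μ) (N : ℕ) : ∫ ω, stack s N ω ∂μ = 0 := by
  have hi := (hasGaussianLaw_stack hl N).integrable
  refine Prod.ext ?_ (Prod.ext (funext fun j => ?_) (funext fun j => ?_))
  · exact ((ContinuousLinearMap.fst ℝ _ _).integral_comp_comm hi).symm.trans
      (integral_eq_zero_of_map_eq hl.measurable_x0 hl.law_x0)
  · exact ((ContinuousLinearMap.proj (R := ℝ) j ∘L ContinuousLinearMap.fst ℝ _ _ ∘L
      ContinuousLinearMap.snd ℝ _ _).integral_comp_comm hi).symm.trans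
      (integral_eq_zero_of_map_eq (hl.measurable_w j) (hl.law_w j))
  · exact ((ContinuousLinearMap.proj (R := ℝ) j ∘L ContinuousLinearMap.snd ℝ _ _ ∘L
      ContinuousLinearMap.snd ℝ _ _).integral_comp_comm hi).symm.trans
      (integral_eq_zero_of_map_eq (hl.measurable_v j) (hl.law_v j))

lemma IsStackLinear.measurable {E : Type*} [NormedAddCommGroup E] [NormedSpace ℝ E]
    [MeasurableSpace E] [BorelSpace E] (hl : ClosedLoop p s μ) {N : ℕ} {X : Ω → E}
    (hX : IsStackLinear s N X) : Measurable X := by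
  obtain ⟨L, hL⟩ := hX
  rw [funext hL]
  exact L.measurable.comp (measurable_stack hl N)

lemma IsStackLinear.hasGaussianLaw {E : Type*} [NormedAddCommGroup E] [NormedSpace ℝ E]
    [MeasurableSpace E] [BorelSpace E] (hl : ClosedLoop p s μ) {N : ℕ} {X : Ω → E}
    (hX : IsStackLinear s N X) : HasGaussianLaw X μ := by
  obtain ⟨L, hL⟩ := hX
  rw [funext hL]
  exact (hasGaussianLaw_stack hl N).map_fun L

lemma IsStackLinear.integral_eq_zero {E : Type*} [NormedAddCommGroup E] [NormedSpace ℝ E]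
    [CompleteSpace E] (hl : ClosedLoop p s μ) {N : ℕ} {X : Ω → E}
    (hX : IsStackLinear s N X) : ∫ ω, X ω ∂μ = 0 := by
  obtain ⟨L, hL⟩ := hX
  simp_rw [hL]
  rw [L.integral_comp_comm (hasGaussianLaw_stack hl N).integrable, integral_stack hl, map_zero]

lemma sensorInfo_le (hl : ClosedLoop p s μ) (k : ℕ) : sensorInfo p s k ≤ mΩ :=
  iSup₂_le fun t _ => ((isStackLinear_meas (lt_add_one t)).measurable hl).comap_le

lemma measurable_localEst (k : ℕ) : Measurable[sensorInfo p s k] (localEst p s μ k) :=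
  stronglyMeasurable_condExp.measurable

variable [IsProbabilityMeasure μ]

/-- Gaussian regression of the state on the measurements. The horizon N is free, so that estimates
at different times can be written over one common stack and are jointly Gaussian. -/
lemma exists_localEst_ae_eq (hl : ClosedLoop p s μ) {k N : ℕ} (hk : k < N) :
    (∃ X, IsStackLinear s N X ∧ localEst p s μ k =ᵐ[μ] X) ∧
    IndepFun (localErr p s μ k) (measVec p s k) μ := by
  obtain ⟨L, hL⟩ := isStackLinear_state (p := p) (s := s) hk.le
  obtain ⟨K, hK⟩ := isStackLinear_measVec (p := p) (s := s) hk
  obtain ⟨M, hM, hM'⟩ := exists_gaussian_regression (measurable_stack hl N)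
    (hasGaussianLaw_stack hl N) (integral_stack hl N) L K
  have hae : localEst p s μ k =ᵐ[μ] fun ω => M (K (stack s N ω)) := by
    rw [localEst, sensorInfo_eq_comap, funext hL, funext hK]
    exact hM'
  refine ⟨⟨_, ⟨M ∘L K, fun ω => rfl⟩, hae⟩, ?_⟩
  refine hM.congr ?_ ?_
  · filter_upwards [hae] with ω h
    rw [localErr, h, hL]
  · exact ae_of_all _ fun ω => (hK ω).symm

end LocalFilter

/-! ### One-step innovations of the filter: independence and covariance. -/

section Innovation

open scoped ENNReal RealInnerProductSpace

variable {n m : ℕ} {Ω : Type*} {p : Parameters n m} {s : Signals n m Ω}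
  [mΩ : MeasurableSpace Ω] {μ : Measure Ω}

lemma covariance_inner_eq_zero_of_indepFun {E E' : Type*} [NormedAddCommGroup E]
    [InnerProductSpace ℝ E] [MeasurableSpace E] [BorelSpace E] [NormedAddCommGroup E']
    [InnerProductSpace ℝ E'] [MeasurableSpace E'] [BorelSpace E'] {X : Ω → E}
    {Y : Ω → E'} (hX : MemLp X 2 μ) (hY : MemLp Y 2 μ) (h : IndepFun X Y μ) (a : E) (b : E') :
    cov[fun ω => ⟪a, X ω⟫, fun ω => ⟪b, Y ω⟫; μ] = 0 := by
  refine IndepFun.covariance_eq_zero ?_ (hX.const_inner a) (hY.const_inner b)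
  exact h.comp (φ := fun x => ⟪a, x⟫) (ψ := fun y => ⟪b, y⟫)
    (innerSL ℝ a).measurable (innerSL ℝ b).measurable

lemma covariance_inner_of_map_eq {X : Ω → EuclideanSpace ℝ (Fin n)} (hX : Measurable X)
    {S : Matrix (Fin n) (Fin n) ℝ} (hS : S.PosSemidef)
    (h : μ.map X = multivariateGaussian 0 S) (a b : EuclideanSpace ℝ (Fin n)) :
    cov[fun ω => ⟪a, X ω⟫, fun ω => ⟪b, X ω⟫; μ] = ⟪a, act S b⟫ := by
  rw [← covariance_map_fun (X := fun x => ⟪a, x⟫) (Y := fun x => ⟪b, x⟫) (by fun_prop)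
    (by fun_prop) hX.aemeasurable, h,
    ← covarianceBilin_apply_eq_cov IsGaussian.memLp_two_id,
    covarianceBilin_multivariateGaussian hS, EuclideanSpace.inner_eq_star_dotProduct,
    dotProduct_comm]
  rfl

lemma indepFun_x0_w (hl : ClosedLoop p s μ) (k : ℕ) : IndepFun s.x0 (s.w k) μ :=
  hl.indep_x0.comp (φ := id)
    (ψ := fun x : (ℕ → EuclideanSpace ℝ (Fin n)) × (ℕ → EuclideanSpace ℝ (Fin m)) => x.1 k)
    measurable_id (by fun_prop)

lemma indepFun_v_w (hl : ClosedLoop p s μ) (t k : ℕ) : IndepFun (s.v t) (s.w k) μ :=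
  hl.indep_w_v.symm.comp (φ := fun x : ℕ → EuclideanSpace ℝ (Fin m) => x t)
    (ψ := fun x : ℕ → EuclideanSpace ℝ (Fin n) => x k) (by fun_prop) (by fun_prop)

lemma memLp_w (hl : ClosedLoop p s μ) (k : ℕ) : MemLp (s.w k) 2 μ :=
  ((isStackLinear_w (lt_add_one k)).hasGaussianLaw hl).memLp_two

lemma memLp_state (hl : ClosedLoop p s μ) (k : ℕ) : MemLp (state p s k) 2 μ :=
  ((isStackLinear_state le_rfl).hasGaussianLaw hl).memLp_two

lemma memLp_act {a b : ℕ} (M : Matrix (Fin a) (Fin b) ℝ) {X : Ω → EuclideanSpace ℝ (Fin b)}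
    (hX : MemLp X 2 μ) : MemLp (fun ω => act M (X ω)) 2 μ :=
  (actCLM M).comp_memLp' hX

lemma memLp_meas (hl : ClosedLoop p s μ) (k : ℕ) : MemLp (meas p s k) 2 μ :=
  ((isStackLinear_meas (lt_add_one k)).hasGaussianLaw hl).memLp_two

lemma memLp_measVec (hl : ClosedLoop p s μ) (k : ℕ) : MemLp (measVec p s k) 2 μ :=
  ((isStackLinear_measVec (lt_add_one k)).hasGaussianLaw hl).memLp_two

/-- A variable independent of `(y_1, …, y_k)` is independent of every function of it. -/
lemma indepFun_of_measurable_sensorInfo {E E' : Type*} [MeasurableSpace E] [MeasurableSpace E']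
    {X : Ω → E} {k : ℕ} (h : IndepFun X (measVec p s k) μ) {Y : Ω → E'}
    (hY : Measurable[sensorInfo p s k] Y) : IndepFun X Y μ := by
  rw [sensorInfo_eq_comap] at hY
  exact indep_of_indep_of_le_right h hY.comap_le

/-- The one-step innovation `x̂_{k+1} - A x̂_k` of the local estimate. -/
noncomputable def stepInnov (p : Parameters n m) (s : Signals n m Ω) (μ : Measure Ω) (k : ℕ) (ω : Ω) :
    EuclideanSpace ℝ (Fin n) :=
  localEst p s μ (k + 1) ω - act p.A (localEst p s μ k ω)

lemma stepInnov_eq (k : ℕ) (ω : Ω) :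
    stepInnov p s μ k ω =
      act p.A (localErr p s μ k ω) + s.w k ω - localErr p s μ (k + 1) ω := by
  simp only [stepInnov, localErr, state, act_sub]
  abel

lemma measurable_stepInnov (k : ℕ) :
    Measurable[sensorInfo p s (k + 1)] (stepInnov p s μ k) :=
  (measurable_localEst (k + 1)).sub ((measurable_act p.A).comp
    ((measurable_localEst k).mono (sensorInfo_mono k.le_succ) le_rfl))

variable [IsProbabilityMeasure μ]

lemma covariance_state_w (hl : ClosedLoop p s μ) {j k : ℕ} (hj : j ≤ k)
    (a b : EuclideanSpace ℝ (Fin n)) :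
    cov[fun ω => ⟪a, state p s j ω⟫, fun ω => ⟪b, s.w k ω⟫; μ] = 0 := by
  induction j generalizing a with
  | zero =>
    exact covariance_inner_eq_zero_of_indepFun (memLp_state (p := p) hl 0)
      (memLp_w hl k) (indepFun_x0_w hl k) a b
  | succ j ih =>
    have h1 : (fun ω => ⟪a, state p s (j + 1) ω⟫) =
        (fun ω => ⟪act p.Aᵀ a, state p s j ω⟫) + fun ω => ⟪a, s.w j ω⟫ := by
      funext ω
      rw [Pi.add_apply, state, inner_add_right, inner_act_right, Matrix.transpose_transpose]
    rw [h1, covariance_add_left ((memLp_state hl j).const_inner _) ((memLp_w hl j).const_inner a)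
      ((memLp_w hl k).const_inner b), ih (by omega), zero_add]
    exact covariance_inner_eq_zero_of_indepFun (memLp_w hl j) (memLp_w hl k)
      (hl.indep_w.indepFun (by omega)) a b

lemma covariance_meas_w (hl : ClosedLoop p s μ) {j k : ℕ} (hj : j ≤ k)
    (a : EuclideanSpace ℝ (Fin m)) (b : EuclideanSpace ℝ (Fin n)) :
    cov[fun ω => ⟪a, meas p s j ω⟫, fun ω => ⟪b, s.w k ω⟫; μ] = 0 := by
  have hv : MemLp (s.v j) 2 μ :=
    ((isStackLinear_v (lt_add_one j)).hasGaussianLaw hl).memLp_two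
  have h1 : (fun ω => ⟪a, meas p s j ω⟫) =
      (fun ω => ⟪act p.Cᵀ a, state p s j ω⟫) + fun ω => ⟪a, s.v j ω⟫ := by
    funext ω
    rw [Pi.add_apply, meas, inner_add_right, inner_act_right p.Cᵀ, Matrix.transpose_transpose]
  rw [h1, covariance_add_left ((memLp_state hl j).const_inner _) (hv.const_inner a)
    ((memLp_w hl k).const_inner b), covariance_state_w hl hj, zero_add]
  exact covariance_inner_eq_zero_of_indepFun hv (memLp_w hl k) (indepFun_v_w hl j k) a b

/-- The noise w_k enters the state only from time k + 1 on, so it is uncorrelated with y_1, …, y_k;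
joint Gaussianity does the rest. -/
lemma indepFun_w_measVec (hl : ClosedLoop p s μ) (k : ℕ) :
    IndepFun (s.w k) (measVec p s k) μ := by
  refine HasGaussianLaw.indepFun_of_covariance_inner
    (((isStackLinear_w (lt_add_one k)).prodMk
      (isStackLinear_measVec (lt_add_one k))).hasGaussianLaw hl) fun a b => ?_
  simp_rw [PiLp.inner_apply b]
  rw [covariance_fun_sum_right (fun t => ?_) ((memLp_w hl k).const_inner a)]
  · refine Finset.sum_eq_zero fun t _ => ?_
    rw [covariance_comm]
    exact covariance_meas_w hl (Finset.mem_Icc.mp t.2).2 _ _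
  · exact (memLp_meas hl t).const_inner _

lemma hasGaussianLaw_localEst (hl : ClosedLoop p s μ) (k : ℕ) :
    HasGaussianLaw (localEst p s μ k) μ := by
  obtain ⟨⟨X, hX, hae⟩, -⟩ := exists_localEst_ae_eq hl (lt_add_one k)
  exact (hX.hasGaussianLaw hl).congr hae.symm

lemma memLp_localEst (hl : ClosedLoop p s μ) (k : ℕ) : MemLp (localEst p s μ k) 2 μ :=
  (hasGaussianLaw_localEst hl k).memLp_two

lemma memLp_localErr (hl : ClosedLoop p s μ) (k : ℕ) : MemLp (localErr p s μ k) 2 μ :=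
  (memLp_state hl k).sub (memLp_localEst hl k)

lemma integral_localErr (hl : ClosedLoop p s μ) (k : ℕ) : ∫ ω, localErr p s μ k ω ∂μ = 0 := by
  unfold localErr
  rw [integral_sub ((memLp_state hl k).integrable (by norm_num))
    ((memLp_localEst hl k).integrable (by norm_num)), localEst,
    integral_condExp (sensorInfo_le hl k), sub_self]

lemma covariance_localErr (hl : ClosedLoop p s μ) {Pbar : Matrix (Fin n) (Fin n) ℝ}
    (hs : SteadyState p s μ Pbar) (k : ℕ) (a b : EuclideanSpace ℝ (Fin n)) :
    cov[fun ω => ⟪a, localErr p s μ k ω⟫, fun ω => ⟪b, localErr p s μ k ω⟫; μ] =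
      ⟪a, act Pbar b⟫ := by
  have hm : ∀ i, MemLp (fun ω => localErr p s μ k ω i) 2 μ := fun i =>
    (EuclideanSpace.proj (𝕜 := ℝ) i).comp_memLp' (memLp_localErr hl k)
  have h0 : ∀ i, ∫ ω, localErr p s μ k ω i ∂μ = 0 := fun i => by
    have := (EuclideanSpace.proj (𝕜 := ℝ) i).integral_comp_comm
      ((memLp_localErr (p := p) hl k).integrable (by norm_num))
    rw [integral_localErr hl, map_zero] at this
    exact this
  have hij : ∀ i j, cov[fun ω => localErr p s μ k ω i, fun ω => localErr p s μ k ω j; μ] =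
      Pbar i j := by
    intro i j
    rw [covariance_eq_sub (hm i) (hm j), h0, h0, mul_zero, sub_zero]
    have h1 := integral_condExp (μ := μ) (sensorInfo_le hl k)
      (f := fun ω => localErr p s μ k ω i * localErr p s μ k ω j)
    rw [integral_congr_ae (hs k i j)] at h1
    simpa using h1.symm
  simp_rw [inner_eq_sum_mul]
  rw [covariance_fun_sum_fun_sum (fun i => (hm i).const_mul _) (fun i => (hm i).const_mul _)]
  refine Finset.sum_congr rfl fun i _ => ?_
  simp only [act, Matrix.mulVec, dotProduct, Finset.mul_sum]
  refine Finset.sum_congr rfl fun j _ => ?_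
  rw [covariance_const_mul_left, covariance_const_mul_right, hij]
  ring

lemma steadyState_transpose (hl : ClosedLoop p s μ) {Pbar : Matrix (Fin n) (Fin n) ℝ}
    (hs : SteadyState p s μ Pbar) : Pbarᵀ = Pbar := by
  ext i j
  have h := covariance_localErr hl hs 0 (EuclideanSpace.single i 1) (EuclideanSpace.single j 1)
  rw [covariance_comm, covariance_localErr hl hs] at h
  simpa [act, EuclideanSpace.inner_single_left] using h

lemma memLp_stepInnov (hl : ClosedLoop p s μ) (k : ℕ) : MemLp (stepInnov p s μ k) 2 μ :=
  (memLp_localEst hl (k + 1)).sub (memLp_act p.A (memLp_localEst hl k))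

/-- Each term of A e_k + w_k - e_{k+1} is uncorrelated with y_1, …, y_k, and the whole is jointly
Gaussian with them. -/
lemma indepFun_stepInnov (hl : ClosedLoop p s μ) (k : ℕ) :
    IndepFun (measVec p s k) (stepInnov p s μ k) μ := by
  -- The estimate at time k + 1 uses v_{k+1}, so the common stack must reach beyond time k + 1.
  obtain ⟨⟨X, hX, hXae⟩, hi⟩ := exists_localEst_ae_eq hl (show k < k + 2 by omega)
  obtain ⟨⟨Y, hY, hYae⟩, hi'⟩ := exists_localEst_ae_eq hl (lt_add_one (k + 1))
  have hi'' : IndepFun (localErr p s μ (k + 1)) (measVec p s k) μ := by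
    refine indepFun_of_measurable_sensorInfo hi' ?_
    have : Measurable[sensorInfo p s k] (measVec p s k) := by
      rw [sensorInfo_eq_comap]
      exact comap_measurable _
    exact this.mono (sensorInfo_mono k.le_succ) le_rfl
  have hg : HasGaussianLaw (fun ω => (stepInnov p s μ k ω, measVec p s k ω)) μ := by
    obtain ⟨L, hL⟩ := hX
    obtain ⟨L', hL'⟩ := hY
    have hlin : IsStackLinear s (k + 1 + 1) fun ω => Y ω - act p.A (X ω) :=
      ⟨L' - actCLM p.A ∘L L, fun ω => by simp [hL, hL']⟩
    refine ((hlin.prodMk (isStackLinear_measVec (p := p)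
      (show k < k + 1 + 1 by omega))).hasGaussianLaw hl).congr ?_
    filter_upwards [hXae, hYae] with ω h1 h2
    rw [stepInnov, h1, h2]
  refine (HasGaussianLaw.indepFun_of_covariance_inner hg fun a b => ?_).symm
  have h1 : (fun ω => ⟪a, stepInnov p s μ k ω⟫) =
      (fun ω => ⟪act p.Aᵀ a, localErr p s μ k ω⟫) + (fun ω => ⟪a, s.w k ω⟫) -
        fun ω => ⟪a, localErr p s μ (k + 1) ω⟫ := by
    funext ω
    rw [stepInnov_eq, Pi.sub_apply, Pi.add_apply, inner_sub_right, inner_add_right,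
      inner_act_right, Matrix.transpose_transpose]
  have m1 := (memLp_localErr (p := p) hl k).const_inner (𝕜 := ℝ) (act p.Aᵀ a)
  have m2 := (memLp_w hl k).const_inner (𝕜 := ℝ) a
  have m3 := (memLp_localErr (p := p) hl (k + 1)).const_inner (𝕜 := ℝ) a
  have m4 := (memLp_measVec (p := p) hl k).const_inner (𝕜 := ℝ) b
  rw [h1, covariance_sub_left (m1.add m2) m3 m4, covariance_add_left m1 m2 m4,
    covariance_inner_eq_zero_of_indepFun (memLp_localErr hl k) (memLp_measVec hl k) hi,
    covariance_inner_eq_zero_of_indepFun (memLp_w hl k) (memLp_measVec hl k)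
      (indepFun_w_measVec hl k),
    covariance_inner_eq_zero_of_indepFun (memLp_localErr hl (k + 1)) (memLp_measVec hl k) hi'']
  ring

lemma covariance_localErr_w (hl : ClosedLoop p s μ) (k : ℕ) (a b : EuclideanSpace ℝ (Fin n)) :
    cov[fun ω => ⟪a, localErr p s μ k ω⟫, fun ω => ⟪b, s.w k ω⟫; μ] = 0 := by
  have h1 : (fun ω => ⟪a, localErr p s μ k ω⟫) =
      (fun ω => ⟪a, state p s k ω⟫) - fun ω => ⟪a, localEst p s μ k ω⟫ := by
    funext ω
    rw [Pi.sub_apply, localErr, inner_sub_right]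
  rw [h1, covariance_sub_left ((memLp_state hl k).const_inner a)
    ((memLp_localEst hl k).const_inner a) ((memLp_w hl k).const_inner b),
    covariance_state_w hl le_rfl,
    covariance_inner_eq_zero_of_indepFun (memLp_localEst hl k) (memLp_w hl k)
      (indepFun_of_measurable_sensorInfo (indepFun_w_measVec hl k) (measurable_localEst k)).symm,
    sub_zero]

/-- A e_k + w_k is the error in predicting x_{k+1} from y_1, …, y_k; its two terms are uncorrelated,
so the covariances A P̄ A' and Q add. -/
lemma covariance_predErr (hl : ClosedLoop p s μ) {Pbar : Matrix (Fin n) (Fin n) ℝ}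
    (hs : SteadyState p s μ Pbar) (k : ℕ) (a b : EuclideanSpace ℝ (Fin n)) :
    cov[fun ω => ⟪a, act p.A (localErr p s μ k ω) + s.w k ω⟫,
      fun ω => ⟪b, act p.A (localErr p s μ k ω) + s.w k ω⟫; μ] = ⟪a, act (p.h Pbar) b⟫ := by
  have h1 : ∀ a : EuclideanSpace ℝ (Fin n),
      (fun ω => ⟪a, act p.A (localErr p s μ k ω) + s.w k ω⟫) =
      (fun ω => ⟪act p.Aᵀ a, localErr p s μ k ω⟫) + fun ω => ⟪a, s.w k ω⟫ := by
    intro a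
    funext ω
    rw [Pi.add_apply, inner_add_right, inner_act_right, Matrix.transpose_transpose]
  have m1 := fun a : EuclideanSpace ℝ (Fin n) => (memLp_localErr (p := p) hl k).const_inner (𝕜 := ℝ) (act p.Aᵀ a)
  have m2 := fun a : EuclideanSpace ℝ (Fin n) => (memLp_w hl k).const_inner (𝕜 := ℝ) a
  rw [h1, h1, covariance_add_left (m1 a) (m2 a) ((m1 b).add (m2 b)),
    covariance_add_right (m1 a) (m1 b) (m2 b), covariance_add_right (m2 a) (m1 b) (m2 b),
    covariance_comm (fun ω => ⟪a, s.w k ω⟫), covariance_localErr_w hl, covariance_localErr_w hl,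
    covariance_localErr hl hs,
    covariance_inner_of_map_eq (hl.measurable_w k) p.Q_posSemidef (hl.law_w k), inner_act_right,
    Matrix.transpose_transpose, act_act, act_act, add_zero, zero_add, ← inner_add_right]
  congr 1
  simp [Parameters.h, act, Matrix.add_mulVec, Matrix.mul_assoc]

/-- The one-step innovations are centred Gaussian with covariance `h(P̄) - P̄`. -/
lemma map_stepInnov (hl : ClosedLoop p s μ) {Pbar : Matrix (Fin n) (Fin n) ℝ}
    (hs : SteadyState p s μ Pbar) (k : ℕ) :
    (p.h Pbar - Pbar).PosSemidef ∧
      μ.map (stepInnov p s μ k) = multivariateGaussian 0 (p.h Pbar - Pbar) := by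
  have hPt := steadyState_transpose hl hs
  have hQt := transpose_eq_of_posSemidef p.Q_posSemidef
  obtain ⟨⟨X, ⟨L, hL⟩, hXae⟩, -⟩ := exists_localEst_ae_eq hl (show k < k + 2 by omega)
  obtain ⟨⟨Y, ⟨L', hL'⟩, hYae⟩, hi'⟩ := exists_localEst_ae_eq hl (lt_add_one (k + 1))
  have hlin : IsStackLinear s (k + 1 + 1) fun ω => Y ω - act p.A (X ω) :=
    ⟨L' - actCLM p.A ∘L L, fun ω => by simp [hL, hL']⟩
  have hae : stepInnov p s μ k =ᵐ[μ] fun ω => Y ω - act p.A (X ω) := by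
    filter_upwards [hXae, hYae] with ω h1 h2
    rw [stepInnov, h1, h2]
  refine map_eq_multivariateGaussian ((hlin.hasGaussianLaw hl).congr hae.symm) ?_ ?_ fun a b => ?_
  · rw [integral_congr_ae hae, hlin.integral_eq_zero hl]
  · simp only [Parameters.h, Matrix.transpose_sub, Matrix.transpose_add, Matrix.transpose_mul,
      Matrix.transpose_transpose, hPt, hQt, Matrix.mul_assoc]
  -- The prediction error is the sum of the innovation and the new error, which are uncorrelated, so
  -- covariances subtract.
  · have h1 : ∀ a : EuclideanSpace ℝ (Fin n),
        (fun ω => ⟪a, act p.A (localErr p s μ k ω) + s.w k ω⟫) =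
        (fun ω => ⟪a, stepInnov p s μ k ω⟫) + fun ω => ⟪a, localErr p s μ (k + 1) ω⟫ := by
      intro a
      funext ω
      rw [Pi.add_apply, stepInnov_eq, inner_sub_right, sub_add_cancel]
    have m1 := fun a : EuclideanSpace ℝ (Fin n) => (memLp_stepInnov (p := p) hl k).const_inner (𝕜 := ℝ) a
    have m2 := fun a : EuclideanSpace ℝ (Fin n) => (memLp_localErr (p := p) hl (k + 1)).const_inner (𝕜 := ℝ) a
    have hz : ∀ a b, cov[fun ω => ⟪a, localErr p s μ (k + 1) ω⟫,
        fun ω => ⟪b, stepInnov p s μ k ω⟫; μ] = 0 := fun a b =>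
      covariance_inner_eq_zero_of_indepFun (memLp_localErr hl (k + 1)) (memLp_stepInnov hl k)
        (indepFun_of_measurable_sensorInfo hi' (measurable_stepInnov k)) a b
    have h2 := covariance_predErr hl hs k a b
    rw [h1, h1, covariance_add_left (m1 a) (m2 a) ((m1 b).add (m2 b)),
      covariance_add_right (m1 a) (m1 b) (m2 b), covariance_add_right (m2 a) (m1 b) (m2 b),
      covariance_comm (fun ω => ⟪a, stepInnov p s μ k ω⟫) (fun ω => ⟪b, localErr p s μ (k + 1) ω⟫),
      hz, hz, covariance_localErr hl hs] at h2
    have h3 : act (p.h Pbar - Pbar) b = act (p.h Pbar) b - act Pbar b := by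
      simp [act, Matrix.sub_mulVec]
    rw [h3, inner_sub_right]
    linarith

end Innovation

/-! ### The holding time and its measurability. -/

section HoldingTime

variable {n m : ℕ} {Ω : Type*} {p : Parameters n m} {s : Signals n m Ω}

/-- The σ-algebra generated by the channel outcomes `γ_1, …, γ_k`. -/
abbrev channelInfo (s : Signals n m Ω) (k : ℕ) : MeasurableSpace Ω :=
  ⨆ t ∈ Finset.Icc 1 k, MeasurableSpace.comap (s.γ t) inferInstance

lemma channelInfo_mono : Monotone (channelInfo s) := fun _ _ h =>
  biSup_mono fun _ ht => Finset.Icc_subset_Icc_right h ht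

lemma one_le_holdingTime (k : ℕ) (ω : Ω) : 1 ≤ holdingTime s (k + 1) ω := by
  classical
  have : Nat.findGreatest (fun t => s.γ t ω = 1) k ≤ k := Nat.findGreatest_le k
  simp only [holdingTime, Nat.add_sub_cancel]
  convert (show 1 ≤ k + 1 - Nat.findGreatest (fun t => s.γ t ω = 1) k by omega)

lemma holdingTime_le (k : ℕ) (ω : Ω) : holdingTime s k ω ≤ k := Nat.sub_le _ _

lemma holdingTime_of_eq_one {k : ℕ} {ω : Ω} (h : s.γ k ω = 1) : holdingTime s (k + 1) ω = 1 := by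
  simp only [holdingTime, Nat.add_sub_cancel]
  rw [Nat.findGreatest_eq h]
  omega

lemma holdingTime_of_ne_one {k : ℕ} {ω : Ω} (h : s.γ (k + 1) ω ≠ 1) :
    holdingTime s (k + 2) ω = holdingTime s (k + 1) ω + 1 := by
  simp only [holdingTime, Nat.add_sub_cancel, show k + 2 - 1 = k + 1 by omega]
  rw [Nat.findGreatest_of_not h]
  refine Nat.sub_add_comm (n := k + 1) (m := 1) (le_trans ?_ k.le_succ)
  exact Nat.findGreatest_le k

lemma measurable_holdingTime (h0 : ∀ ω, s.γ 0 ω = 1) (k : ℕ) :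
    Measurable[channelInfo s k] (holdingTime s (k + 1)) := by
  refine Measurable.comp (g := fun t => k + 1 - t) Measurable.of_discrete ?_
  refine @measurable_findGreatest _ (channelInfo s k) _ _ _ fun t ht => ?_
  -- The outcome γ_0 is not among the generators, but it is constantly 1.
  rcases Nat.eq_zero_or_pos t with rfl | ht0
  · simp only [h0]
    exact @MeasurableSet.univ _ (channelInfo s k)
  · exact le_iSup₂_of_le (f := fun t (_ : t ∈ Finset.Icc 1 k) =>
      MeasurableSpace.comap (s.γ t) inferInstance) t (Finset.mem_Icc.mpr ⟨ht0, ht⟩) le_rfl _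
      ⟨{1}, measurableSet_singleton 1, rfl⟩

/-- Needed because the innovation and the power evaluate estimates and weights at a random holding
time. -/
lemma measurable_comp_nat {E : Type*} [MeasurableSpace E] {m' : MeasurableSpace Ω} {τ : Ω → ℕ}
    (hτ : Measurable τ) {g : ℕ → Ω → E} (hg : ∀ t, Measurable (g t)) :
    Measurable fun ω => g (τ ω) ω :=
  (measurable_from_prod_countable_right (f := fun x : ℕ × Ω => g x.1 x.2) hg).comp
    (hτ.prodMk measurable_id)

lemma measurable_state_preChannelInfo (j k : ℕ) :
    Measurable[preChannelInfo s k] (state p s j) := by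
  induction j with
  | zero =>
    exact (comap_measurable s.x0).mono
      ((le_sup_left.trans le_sup_left).trans le_sup_left) le_rfl
  | succ j ih =>
    have hw : Measurable[preChannelInfo s k] (s.w j) :=
      (comap_measurable (s.w j)).mono ((le_iSup (fun j => MeasurableSpace.comap (s.w j)
        inferInstance) j).trans ((le_sup_right.trans le_sup_left).trans le_sup_left)) le_rfl
    exact ((measurable_act p.A).comp ih).add hw

/-- The measurements up to time `j` and the channel outcomes up to time `k`. -/
abbrev sensorChannelInfo (p : Parameters n m) (s : Signals n m Ω) (j k : ℕ) : MeasurableSpace Ω :=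
  sensorInfo p s j ⊔ channelInfo s k

/-- No relation between j and k is needed, since the pre-channel σ-algebra contains the noises of
all times. Hence the channel law can be integrated over events involving later measurements. -/
lemma sensorChannelInfo_le_preChannelInfo (j k : ℕ) :
    sensorChannelInfo p s j k ≤ preChannelInfo s (k + 1) := by
  refine sup_le (iSup₂_le fun t _ => ?_) (le_trans (le_of_eq ?_) le_sup_right)
  · have hv : Measurable[preChannelInfo s (k + 1)] (s.v t) :=
      (comap_measurable (s.v t)).mono ((le_iSup (fun j => MeasurableSpace.comap (s.v j)
        inferInstance) t).trans (le_sup_right.trans le_sup_left)) le_rfl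
    exact Measurable.comap_le (m₁ := preChannelInfo s (k + 1))
      (((measurable_act p.C).comp (measurable_state_preChannelInfo t (k + 1))).add hv)
  · rw [show Finset.Ico 1 (k + 1) = Finset.Icc 1 k from rfl]

end HoldingTime

/-! ### Drop probabilities and independence of the innovations from the channel. -/

section Channel

open scoped ENNReal

variable {n m : ℕ} {Ω : Type*} {p : Parameters n m} {s : Signals n m Ω}
  [mΩ : MeasurableSpace Ω] {μ : Measure Ω}

lemma channelInfo_le (hl : ClosedLoop p s μ) (k : ℕ) : channelInfo s k ≤ mΩ :=
  iSup₂_le fun t _ => (hl.measurable_γ t).comap_le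

lemma sensorChannelInfo_le (hl : ClosedLoop p s μ) (j k : ℕ) : sensorChannelInfo p s j k ≤ mΩ :=
  sup_le (sensorInfo_le hl j) (channelInfo_le hl k)

lemma measurable_innov (hl : ClosedLoop p s μ) (k : ℕ) :
    Measurable[sensorChannelInfo p s (k + 1) k] (innov p s μ (k + 1)) := by
  refine @measurable_comp_nat _ _ _ (sensorChannelInfo p s (k + 1) k) _
    ((measurable_holdingTime hl.γ_zero k).mono le_sup_right le_rfl)
    (fun t ω => localEst p s μ (k + 1) ω - act (p.A ^ t) (localEst p s μ (k + 1 - t) ω))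
    fun t => ?_
  exact ((measurable_localEst (k + 1)).sub ((measurable_act _).comp
    ((measurable_localEst (k + 1 - t)).mono (sensorInfo_mono (Nat.sub_le _ _)) le_rfl))).mono
    le_sup_left le_rfl

lemma measurable_power (hl : ClosedLoop p s μ) (k : ℕ) :
    Measurable[sensorChannelInfo p s (k + 1) k] (power p s μ (k + 1)) := by
  refine @measurable_comp_nat _ _ _ (sensorChannelInfo p s (k + 1) k) _
    ((measurable_holdingTime hl.γ_zero k).mono le_sup_right le_rfl)
    (fun t ω => p.N0 * p.W / (2 * p.α) * ((innov p s μ (k + 1) ω).ofLp ⬝ᵥ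
      (p.wt t *ᵥ (innov p s μ (k + 1) ω).ofLp)) + p.pow0) fun t => ?_
  have : Continuous fun x : EuclideanSpace ℝ (Fin n) => p.N0 * p.W / (2 * p.α) *
      (x.ofLp ⬝ᵥ (p.wt t *ᵥ x.ofLp)) + p.pow0 := by fun_prop
  exact this.measurable.comp (measurable_innov hl k)

lemma innov_of_holdingTime_eq_one {k : ℕ} {ω : Ω} (h : holdingTime s (k + 1) ω = 1) :
    innov p s μ (k + 1) ω = stepInnov p s μ k ω := by
  rw [innov, h, pow_one, Nat.add_sub_cancel, stepInnov]

/-- After a drop the reference time k + 1 - τ is unchanged, so only the newest one-step innovation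
is added. -/
lemma innov_of_ne_one {k : ℕ} {ω : Ω} (h : s.γ (k + 1) ω ≠ 1) :
    innov p s μ (k + 2) ω =
      act p.A (innov p s μ (k + 1) ω) + stepInnov p s μ (k + 1) ω := by
  rw [innov, innov, holdingTime_of_ne_one h, stepInnov, act_sub, act_act, ← pow_succ',
    show k + 2 - (holdingTime s (k + 1) ω + 1) = k + 1 - holdingTime s (k + 1) ω by omega]
  abel

lemma preChannelInfo_le (hl : ClosedLoop p s μ) (k : ℕ) : preChannelInfo s k ≤ mΩ :=
  sup_le (sup_le (sup_le hl.measurable_x0.comap_le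
    (iSup_le fun j => (hl.measurable_w j).comap_le))
    (iSup_le fun j => (hl.measurable_v j).comap_le))
    (iSup₂_le fun t _ => (hl.measurable_γ t).comap_le)

lemma measurableSet_drop (hl : ClosedLoop p s μ) (k : ℕ) : MeasurableSet (s.γ k ⁻¹' {0}) :=
  hl.measurable_γ k (measurableSet_singleton 0)

lemma q_pos : 0 < p.q := Real.exp_pos _

/-- On a fibre of the holding time, the drop probability is a quadratic-exponential weight. -/
lemma ofReal_dropProb {k t : ℕ} {ω : Ω} (h : holdingTime s k ω = t) :
    ENNReal.ofReal (p.q ^ power p s μ k ω) =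
      (ENNReal.ofReal (Real.exp (-p.α / (p.N0 * p.W) * p.pow0)) • quadWeight (p.wt t))
        (innov p s μ k ω) := by
  have := p.N0_pos
  have := p.W_pos
  have := p.α_pos
  rw [Pi.smul_apply, smul_eq_mul, quadWeight, ← ENNReal.ofReal_mul (Real.exp_pos _).le,
    ← Real.exp_add, Parameters.q, ← Real.exp_mul, power, h]
  -- The factor N₀W / (2α) in the power cancels α / (N₀W) down to 1/2.
  congr 2
  field_simp
  ring

variable [IsProbabilityMeasure μ]

lemma measure_inter_drop (hl : ClosedLoop p s μ) (k : ℕ) {F : Set Ω}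
    (hF : MeasurableSet[preChannelInfo s (k + 1)] F) :
    μ (F ∩ s.γ (k + 1) ⁻¹' {0}) =
      ∫⁻ ω in F, ENNReal.ofReal (p.q ^ power p s μ (k + 1) ω) ∂μ :=
  measure_inter_eq_setLIntegral (preChannelInfo_le hl _) (measurableSet_drop hl _)
    (fun _ => Real.rpow_nonneg q_pos.le _) (hl.channel (k + 1) (by omega)) hF

/-- The conditional drop probability is a power of q > 0, hence positive everywhere, and so is its
integral. -/
lemma measure_drop_pos (hl : ClosedLoop p s μ) (k : ℕ) : 0 < μ (s.γ (k + 1) ⁻¹' {0}) := by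
  have hm : Measurable fun ω => ENNReal.ofReal (p.q ^ power p s μ (k + 1) ω) := by
    have := (measurable_power hl k).mono (sensorChannelInfo_le hl _ _) le_rfl
    exact (measurable_const.pow this).ennreal_ofReal
  have h := measure_inter_drop hl k (F := Set.univ) MeasurableSet.univ
  rw [Set.univ_inter, Measure.restrict_univ] at h
  rw [h, lintegral_pos_iff_support hm]
  have : (Function.support fun ω => ENNReal.ofReal (p.q ^ power p s μ (k + 1) ω)) = Set.univ := by
    ext ω
    simp [Real.rpow_pos_of_pos q_pos]
  rw [this]
  simp

/-- The innovation at time `k + 1` is independent of the measurements up to time `k` and the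
channel outcomes up to time `j ≤ k`. -/
lemma indep_sensorChannelInfo_stepInnov (hl : ClosedLoop p s μ) {j k : ℕ} (hj : j ≤ k) :
    Indep (sensorChannelInfo p s k j)
      (MeasurableSpace.comap (stepInnov p s μ k) inferInstance) μ := by
  have hstep : Measurable (stepInnov p s μ k) :=
    (measurable_stepInnov k).mono (sensorInfo_le hl _) le_rfl
  induction j with
  | zero =>
    have h0 : channelInfo s 0 = ⊥ := by simp [channelInfo]
    rw [sensorChannelInfo, h0, sup_bot_eq, sensorInfo_eq_comap]
    exact indepFun_stepInnov hl k
  | succ j ih =>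
    rw [sensorChannelInfo, channelInfo, iSup_Icc_add_one, ← sup_assoc]
    -- As j + 1 ≤ k, the power at time j + 1 is known from measurements up to time k, so γ_{j+1} can
    -- be adjoined without breaking independence.
    have hp : Measurable[sensorChannelInfo p s k j] (power p s μ (j + 1)) :=
      (measurable_power hl j).mono (sup_le_sup_right (sensorInfo_mono hj) _) le_rfl
    refine indep_sup_comap_of_condProb (sensorChannelInfo_le hl k j) hstep (ih (by omega))
      (hl.measurable_γ _) (hl.γ_mem _)
      (G := fun ω => ENNReal.ofReal (p.q ^ power p s μ (j + 1) ω))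
      (measurable_const.pow hp).ennreal_ofReal fun F hF => measure_inter_drop hl j ?_
    refine sup_le (sensorChannelInfo_le_preChannelInfo k j) ?_ F hF
    exact ((measurable_stepInnov k).mono (le_sup_left.trans
      (sensorChannelInfo_le_preChannelInfo (k + 1) j)) le_rfl).comap_le

end Channel

/-! ### The covariance recursion along drops. -/

section ConditionalLaw

open scoped ENNReal

variable {n m : ℕ} {Ω : Type*} {p : Parameters n m} {s : Signals n m Ω}
  [mΩ : MeasurableSpace Ω] {μ : Measure Ω}

lemma remoteInfo_le_sensorChannelInfo (k : ℕ) :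
    remoteInfo p s μ k ≤ sensorChannelInfo p s k k := by
  refine iSup₂_le fun t ht => ?_
  have hγ : Measurable[sensorChannelInfo p s k k] (s.γ t) :=
    (comap_measurable (s.γ t)).mono ((le_iSup₂_of_le (f := fun t (_ : t ∈ Finset.Icc 1 k) =>
      MeasurableSpace.comap (s.γ t) inferInstance) t ht le_rfl).trans le_sup_right) le_rfl
  have hx : Measurable[sensorChannelInfo p s k k] (localEst p s μ t) :=
    (measurable_localEst t).mono
      ((sensorInfo_mono (Finset.mem_Icc.mp ht).2).trans le_sup_left) le_rfl
  exact sup_le hγ.comap_le (hγ.smul hx).comap_le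

lemma channelInfo_le_remoteInfo (k : ℕ) : channelInfo s k ≤ remoteInfo p s μ k :=
  iSup₂_mono fun _ _ => le_sup_left

/-- On the event of a drop, the remote estimator gains no information. -/
lemma exists_inter_drop_eq (k : ℕ) {F : Set Ω} (hF : MeasurableSet[remoteInfo p s μ (k + 1)] F) :
    ∃ F', MeasurableSet[remoteInfo p s μ k] F' ∧
      F ∩ s.γ (k + 1) ⁻¹' {0} = F' ∩ s.γ (k + 1) ⁻¹' {0} := by
  rw [remoteInfo, iSup_Icc_add_one, ← sup_assoc] at hF
  obtain ⟨F₁, hF₁, h₁⟩ := exists_inter_eq_of_measurableSet_sup_comap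
    (D := s.γ (k + 1) ⁻¹' {0}) (c := (0 : EuclideanSpace ℝ (Fin n)))
    (fun ω h => by rw [show s.γ (k + 1) ω = 0 from h, zero_smul]) hF
  obtain ⟨F₂, hF₂, h₂⟩ := exists_inter_eq_of_measurableSet_sup_comap
    (D := s.γ (k + 1) ⁻¹' {0}) (c := (0 : ℝ)) (fun ω h => h) hF₁
  exact ⟨F₂, hF₂, h₁.trans h₂⟩

/-- Congruence by A, sums and pseudoinverses all preserve semidefiniteness. The shifted pairing lets
one induction serve both sequences. -/
lemma posSemidef_of_recursion {S : Matrix (Fin n) (Fin n) ℝ} (hS : S.PosSemidef)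
    {Sig Psi : ℕ → Matrix (Fin n) (Fin n) ℝ} (hPsi0 : Psi 0 = 0)
    (hSig : ∀ τ, 1 ≤ τ → Sig τ = p.A * Psi (τ - 1) * p.Aᵀ + S)
    (hPsi : ∀ τ, 1 ≤ τ → Psi τ = pinv (p.wt τ + pinv (Sig τ))) (τ : ℕ) :
    (Sig (τ + 1)).PosSemidef ∧ (Psi τ).PosSemidef := by
  have hstep : ∀ τ, (Psi τ).PosSemidef → (Sig (τ + 1)).PosSemidef := fun τ h => by
    rw [hSig (τ + 1) (by omega), Nat.add_sub_cancel]
    have := h.mul_mul_conjTranspose_same p.A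
    rw [Matrix.conjTranspose_eq_transpose_of_trivial] at this
    exact this.add hS
  induction τ with
  | zero =>
    have : (Psi 0).PosSemidef := hPsi0 ▸ Matrix.PosSemidef.zero
    exact ⟨hstep 0 this, this⟩
  | succ τ ih =>
    have : (Psi (τ + 1)).PosSemidef := by
      rw [hPsi _ (by omega)]
      exact pinv_posSemidef ((p.wt_posSemidef _ (by omega)).add (pinv_posSemidef ih.1))
    exact ⟨hstep _ this, this⟩

variable [IsProbabilityMeasure μ]

/-- If, on the part of `F` where the holding time is `t`, the incremental innovation has law
`N(0, S)`, then on the further part where the packet is dropped it has law `N(0, (W_t + S⁺)⁺)`. -/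
lemma map_innov_drop (hl : ClosedLoop p s μ) {k t : ℕ} (ht : 1 ≤ t)
    {S : Matrix (Fin n) (Fin n) ℝ} (hS : S.PosSemidef)
    (hle : (S - pinv (p.wt t + pinv S)).PosSemidef) {F : Set Ω}
    (hF : MeasurableSet[remoteInfo p s μ k] F)
    (h : (μ.restrict (F ∩ holdingTime s (k + 1) ⁻¹' {t})).map (innov p s μ (k + 1)) =
      μ (F ∩ holdingTime s (k + 1) ⁻¹' {t}) • multivariateGaussian 0 S) :
    (μ.restrict (F ∩ holdingTime s (k + 1) ⁻¹' {t} ∩ s.γ (k + 1) ⁻¹' {0})).map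
        (innov p s μ (k + 1)) =
      μ (F ∩ holdingTime s (k + 1) ⁻¹' {t} ∩ s.γ (k + 1) ⁻¹' {0}) •
        multivariateGaussian 0 (pinv (p.wt t + pinv S)) := by
  obtain ⟨c, hc⟩ := exists_withDensity_multivariateGaussian hS (p.wt_posSemidef t ht) hle
  have hpre := sensorChannelInfo_le_preChannelInfo (p := p) (s := s) (k + 1) k
  have hXp : Measurable[preChannelInfo s (k + 1)] (innov p s μ (k + 1)) :=
    (measurable_innov hl k).mono hpre le_rfl
  have hFp : MeasurableSet[preChannelInfo s (k + 1)]
      (F ∩ holdingTime s (k + 1) ⁻¹' {t}) := by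
    refine MeasurableSet.inter ?_ ?_
    · exact ((remoteInfo_le_sensorChannelInfo k).trans
        (sensorChannelInfo_le_preChannelInfo k k)) _ hF
    · exact hpre _ ((le_sup_right : channelInfo s k ≤ sensorChannelInfo p s (k + 1) k) _
        (measurable_holdingTime hl.γ_zero k (measurableSet_singleton t)))
  have hX : Measurable (innov p s μ (k + 1)) := hXp.mono (preChannelInfo_le hl _) le_rfl
  obtain ⟨K, hK⟩ : ∃ K : ℝ≥0∞, (μ.restrict (F ∩ holdingTime s (k + 1) ⁻¹' {t} ∩
      s.γ (k + 1) ⁻¹' {0})).map (innov p s μ (k + 1)) =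
      K • multivariateGaussian 0 (pinv (p.wt t + pinv S)) := by
    rw [map_restrict_inter_eq_withDensity (preChannelInfo_le hl (k + 1)) hXp hFp
      ((measurable_quadWeight (p.wt t)).const_smul _)
      (fun F' hF' => measure_inter_drop hl k hF') fun ω hω => ofReal_dropProb hω.2, h,
      withDensity_smul_measure, withDensity_smul _ (measurable_quadWeight _), hc, smul_smul,
      smul_smul]
    exact ⟨_, rfl⟩
  -- The unknown constant K is identified by total mass.
  have hu := congrArg (fun ν => ν Set.univ) hK
  simp only [Measure.smul_apply, measure_univ, smul_eq_mul, mul_one] at hu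
  rw [Measure.map_apply hX MeasurableSet.univ, Set.preimage_univ, Measure.restrict_apply_univ]
    at hu
  rw [hK, hu]

variable {Pbar : Matrix (Fin n) (Fin n) ℝ} {Sig Psi : ℕ → Matrix (Fin n) (Fin n) ℝ}

/-- On an event of `(y_1, …, y_k, γ_1, …, γ_k)` on which `X`, a function of the same variables,
is `N(0, S)`-distributed, `A X + x̂_{k+1} - A x̂_k` is `N(0, A S A' + h(P̄) - P̄)`-distributed. -/
lemma map_act_add_stepInnov (hl : ClosedLoop p s μ) (hs : SteadyState p s μ Pbar) {k : ℕ}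
    {X : Ω → EuclideanSpace ℝ (Fin n)} (hX : Measurable[sensorChannelInfo p s k k] X)
    {F : Set Ω} (hF : MeasurableSet[sensorChannelInfo p s k k] F)
    {S : Matrix (Fin n) (Fin n) ℝ} (hS : S.PosSemidef)
    (h : (μ.restrict F).map X = μ F • multivariateGaussian 0 S) :
    (μ.restrict F).map (fun ω => act p.A (X ω) + stepInnov p s μ k ω) =
      μ F • multivariateGaussian 0 (p.A * S * p.Aᵀ + (p.h Pbar - Pbar)) := by
  have hm := sensorChannelInfo_le hl k k
  have hX' : Measurable X := hX.mono hm le_rfl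
  have hY : Measurable (stepInnov p s μ k) :=
    (measurable_stepInnov k).mono (sensorInfo_le hl _) le_rfl
  obtain ⟨hpos, hlaw⟩ := map_stepInnov hl hs k
  have hpos' : (p.A * S * p.Aᵀ).PosSemidef := by
    have := hS.mul_mul_conjTranspose_same p.A
    rwa [Matrix.conjTranspose_eq_transpose_of_trivial] at this
  have h1 : (fun ω => act p.A (X ω) + stepInnov p s μ k ω) =
      (fun x : EuclideanSpace ℝ (Fin n) × EuclideanSpace ℝ (Fin n) => x.1 + x.2) ∘
        Prod.map (act p.A) id ∘ fun ω => (X ω, stepInnov p s μ k ω) := rfl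
  rw [h1, ← Measure.map_map (by fun_prop) (by fun_prop),
    ← Measure.map_map (by fun_prop) (hX'.prodMk hY),
    map_restrict_prodMk_of_indep hm hX hY (indep_sensorChannelInfo_stepInnov hl le_rfl) hF, h,
    hlaw, Measure.prod_smul_left, Measure.map_smul, Measure.map_smul,
    ← Measure.map_prod_map _ _ (by fun_prop) measurable_id, Measure.map_id,
    map_act_multivariateGaussian hS, ← conv_multivariateGaussian hpos' hpos]
  rfl

/-- After a reception the incremental innovation is a one-step innovation, independent of everything
in F. -/
lemma map_innov_of_holdingTime_eq_one (hl : ClosedLoop p s μ) (hs : SteadyState p s μ Pbar)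
    {k : ℕ} {F : Set Ω} (hF : MeasurableSet[sensorChannelInfo p s k k] F)
    (h : ∀ ω ∈ F, holdingTime s (k + 1) ω = 1) :
    (μ.restrict F).map (innov p s μ (k + 1)) =
      μ F • multivariateGaussian 0 (p.h Pbar - Pbar) := by
  have hm := sensorChannelInfo_le hl k k
  have hY : Measurable (stepInnov p s μ k) :=
    (measurable_stepInnov k).mono (sensorInfo_le hl _) le_rfl
  have hae : innov p s μ (k + 1) =ᵐ[μ.restrict F] stepInnov p s μ k :=
    ae_restrict_of_forall_mem (hm F hF) fun ω hω => innov_of_holdingTime_eq_one (h ω hω)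
  rw [Measure.map_congr hae, ← (map_stepInnov hl hs k).2]
  ext B hB
  rw [Measure.map_apply hY hB, Measure.restrict_apply (hY hB), Measure.smul_apply,
    Measure.map_apply hY hB, smul_eq_mul, Set.inter_comm]
  exact (Indep_iff _ _ _).mp (indep_sensorChannelInfo_stepInnov hl le_rfl) _ _ hF ⟨B, hB, rfl⟩

/-- On each fibre of the holding time, the incremental innovation is independent of the remote
information with the law prescribed by the covariance recursion. -/
lemma map_innov_restrict (hl : ClosedLoop p s μ) (hs : SteadyState p s μ Pbar)
    (hPsi0 : Psi 0 = 0)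
    (hSig : ∀ τ, 1 ≤ τ → Sig τ = p.A * Psi (τ - 1) * p.Aᵀ + (p.h Pbar - Pbar))
    (hPsi : ∀ τ, 1 ≤ τ → Psi τ = pinv (p.wt τ + pinv (Sig τ)))
    (hle : ∀ τ, 1 ≤ τ → (Sig τ - Psi τ).PosSemidef) (k : ℕ) {F : Set Ω}
    (hF : MeasurableSet[remoteInfo p s μ k] F) (t : ℕ) :
    (μ.restrict (F ∩ holdingTime s (k + 1) ⁻¹' {t})).map (innov p s μ (k + 1)) =
        μ (F ∩ holdingTime s (k + 1) ⁻¹' {t}) • multivariateGaussian 0 (Sig t) ∧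
      (μ.restrict (F ∩ holdingTime s (k + 1) ⁻¹' {t} ∩ s.γ (k + 1) ⁻¹' {0})).map
          (innov p s μ (k + 1)) =
        μ (F ∩ holdingTime s (k + 1) ⁻¹' {t} ∩ s.γ (k + 1) ⁻¹' {0}) •
          multivariateGaussian 0 (Psi t) := by
  have hpsd := posSemidef_of_recursion (map_stepInnov hl hs 0).1 hPsi0 hSig hPsi
  have hempty : ∀ (k : ℕ) (t : ℕ), t = 0 ∨ k + 1 < t →
      holdingTime s (k + 1) ⁻¹' {t} = ∅ := by
    intro k t ht
    ext ω
    have h1 := one_le_holdingTime (s := s) k ω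
    have h2 := holdingTime_le (s := s) (k + 1) ω
    simp only [Set.mem_preimage, Set.mem_singleton_iff, Set.mem_empty_iff_false, iff_false]
    omega
  have hdrop : ∀ (k : ℕ) {F : Set Ω} (_ : MeasurableSet[remoteInfo p s μ k] F) (t : ℕ),
      (μ.restrict (F ∩ holdingTime s (k + 1) ⁻¹' {t})).map (innov p s μ (k + 1)) =
        μ (F ∩ holdingTime s (k + 1) ⁻¹' {t}) • multivariateGaussian 0 (Sig t) →
      (μ.restrict (F ∩ holdingTime s (k + 1) ⁻¹' {t} ∩ s.γ (k + 1) ⁻¹' {0})).map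
          (innov p s μ (k + 1)) =
        μ (F ∩ holdingTime s (k + 1) ⁻¹' {t} ∩ s.γ (k + 1) ⁻¹' {0}) •
          multivariateGaussian 0 (Psi t) := by
    intro k F hF t h
    rcases Nat.eq_zero_or_pos t with rfl | ht
    · simp [hempty k 0 (Or.inl rfl)]
    · have hS : (Sig t).PosSemidef := by
        have := (hpsd (t - 1)).1
        rwa [Nat.sub_add_cancel ht] at this
      have hle' := hle t ht
      rw [hPsi t ht] at hle' ⊢
      exact map_innov_drop hl ht hS hle' hF h
  have hmeas : ∀ (k : ℕ) {F : Set Ω} (_ : MeasurableSet[remoteInfo p s μ k] F) (t : ℕ),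
      MeasurableSet[sensorChannelInfo p s k k] (F ∩ holdingTime s (k + 1) ⁻¹' {t}) :=
    fun k F hF t => MeasurableSet.inter (remoteInfo_le_sensorChannelInfo k _ hF)
      ((le_sup_right : channelInfo s k ≤ sensorChannelInfo p s k k) _
        (measurable_holdingTime hl.γ_zero k (measurableSet_singleton t)))
  have hone : ∀ (k : ℕ) {F : Set Ω} (_ : MeasurableSet[remoteInfo p s μ k] F),
      (μ.restrict (F ∩ holdingTime s (k + 1) ⁻¹' {1})).map (innov p s μ (k + 1)) =
        μ (F ∩ holdingTime s (k + 1) ⁻¹' {1}) • multivariateGaussian 0 (Sig 1) := by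
    intro k F hF
    rw [hSig 1 le_rfl, Nat.sub_self, hPsi0, Matrix.mul_zero, Matrix.zero_mul, zero_add]
    exact map_innov_of_holdingTime_eq_one hl hs (hmeas k hF 1) fun ω hω => hω.2
  -- The law on a drop follows from the law before it, so the induction carries only the first
  -- claim, for all F and t at once.
  suffices h : ∀ (F : Set Ω) (_ : MeasurableSet[remoteInfo p s μ k] F) (t : ℕ),
      (μ.restrict (F ∩ holdingTime s (k + 1) ⁻¹' {t})).map (innov p s μ (k + 1)) =
        μ (F ∩ holdingTime s (k + 1) ⁻¹' {t}) • multivariateGaussian 0 (Sig t) from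
    ⟨h F hF t, hdrop k hF t (h F hF t)⟩
  clear hF t F
  induction k with
  | zero =>
    intro F hF t
    by_cases ht : t = 1
    · rw [ht]
      exact hone 0 hF
    · simp [hempty 0 t (by omega)]
  | succ k ih =>
    intro F hF t
    rcases Nat.lt_or_ge t 2 with ht | ht
    · rcases Nat.eq_zero_or_pos t with rfl | ht0
      · simp [hempty (k + 1) 0 (Or.inl rfl)]
      · rw [show t = 1 by omega]
        exact hone (k + 1) hF
    · obtain ⟨t, rfl⟩ : ∃ t', t = t' + 1 := ⟨t - 1, by omega⟩
      have hE := hmeas (k + 1) hF (t + 1)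
      obtain ⟨F', hF', hFF'⟩ := exists_inter_drop_eq k hF
      have hsub : ∀ ω, holdingTime s (k + 2) ω = t + 1 → s.γ (k + 1) ω = 0 := by
        intro ω hω
        rcases hl.γ_mem (k + 1) ω with h | h
        · exact h
        · rw [holdingTime_of_eq_one h] at hω
          omega
      have hne : ∀ ω, s.γ (k + 1) ω = 0 → s.γ (k + 1) ω ≠ 1 := fun ω h => by simp [h]
      -- A holding time t + 1 ≥ 2 forces a drop at time k + 1. There F can be replaced by an event
      -- F' of the previous information, and the previous holding time was t.
      have hset : F ∩ holdingTime s (k + 1 + 1) ⁻¹' {t + 1} =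
          F' ∩ holdingTime s (k + 1) ⁻¹' {t} ∩ s.γ (k + 1) ⁻¹' {0} := by
        ext ω
        have h1 := Set.ext_iff.mp hFF' ω
        have h2 := hsub ω
        have h3 : s.γ (k + 1) ω = 0 →
            holdingTime s (k + 1 + 1) ω = holdingTime s (k + 1) ω + 1 :=
          fun h => holdingTime_of_ne_one (hne ω h)
        simp only [Set.mem_inter_iff, Set.mem_preimage, Set.mem_singleton_iff] at h1 ⊢
        constructor
        · rintro ⟨hf, hτ⟩
          have h0 := h2 hτ
          have := h3 h0
          exact ⟨⟨(h1.mp ⟨hf, h0⟩).1, by omega⟩, h0⟩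
        · rintro ⟨⟨hf, hτ⟩, h0⟩
          have := h3 h0
          exact ⟨(h1.mpr ⟨hf, h0⟩).1, by omega⟩
      have hX : Measurable[sensorChannelInfo p s (k + 1) (k + 1)] (innov p s μ (k + 1)) :=
        (measurable_innov hl k).mono (sup_le_sup_left (channelInfo_mono k.le_succ) _) le_rfl
      have hlaw := hdrop k hF' t (ih F' hF' t)
      rw [← hset] at hlaw
      have hae : innov p s μ (k + 1 + 1) =ᵐ[μ.restrict (F ∩ holdingTime s (k + 1 + 1) ⁻¹' {t + 1})]
          fun ω => act p.A (innov p s μ (k + 1) ω) + stepInnov p s μ (k + 1) ω :=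
        ae_restrict_of_forall_mem (sensorChannelInfo_le hl _ _ _ hE) fun ω hω =>
          innov_of_ne_one (hne ω (hsub ω hω.2))
      rw [Measure.map_congr hae, map_act_add_stepInnov hl hs hX hE (hpsd t).2 hlaw,
        hSig (t + 1) (by omega), Nat.add_sub_cancel]

end ConditionalLaw

end RemoteEstimation

theorem mainTheorem1 {n m : ℕ} {Ω : Type*} [MeasurableSpace Ω]
    (p : RemoteEstimation.Parameters n m) (s : RemoteEstimation.Signals n m Ω)
    (μ : Measure Ω) [IsProbabilityMeasure μ]
    (hloop : RemoteEstimation.ClosedLoop p s μ)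
    (Pbar : Matrix (Fin n) (Fin n) ℝ)
    (hsteady : RemoteEstimation.SteadyState p s μ Pbar)
    (Sig Psi : ℕ → Matrix (Fin n) (Fin n) ℝ)
    (hPsi0 : Psi 0 = 0)
    (hSig : ∀ τ, 1 ≤ τ → Sig τ = p.A * Psi (τ - 1) * p.Aᵀ + (p.h Pbar - Pbar))
    (hPsi : ∀ τ, 1 ≤ τ →
      Psi τ = RemoteEstimation.pinv (p.wt τ + RemoteEstimation.pinv (Sig τ)))
    (hle : ∀ τ, 1 ≤ τ → (Sig τ - Psi τ).PosSemidef) :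
    (∀ τ, 1 ≤ τ → (Sig τ).PosSemidef ∧ (Psi τ).PosSemidef) ∧
    ∀ k, 1 ≤ k →
      RemoteEstimation.HasCondLaw μ (RemoteEstimation.innov p s μ k)
        (RemoteEstimation.remoteInfo p s μ (k - 1))
        (fun ω => multivariateGaussian 0 (Sig (RemoteEstimation.holdingTime s k ω))) ∧
      0 < μ (s.γ k ⁻¹' {0}) ∧
      RemoteEstimation.HasCondLaw (cond μ (s.γ k ⁻¹' {0})) (RemoteEstimation.innov p s μ k)
        (RemoteEstimation.remoteInfo p s μ (k - 1))
        (fun ω => multivariateGaussian 0 (Psi (RemoteEstimation.holdingTime s k ω))) := by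
  have hpsd := RemoteEstimation.posSemidef_of_recursion
    (RemoteEstimation.map_stepInnov hloop hsteady 0).1 hPsi0 hSig hPsi
  refine ⟨fun τ hτ => ⟨?_, (hpsd τ).2⟩, fun k hk => ?_⟩
  · have := (hpsd (τ - 1)).1
    rwa [Nat.sub_add_cancel hτ] at this
  obtain ⟨k, rfl⟩ : ∃ k', k = k' + 1 := ⟨k - 1, by omega⟩
  have hlaw := fun F hF t =>
    RemoteEstimation.map_innov_restrict hloop hsteady hPsi0 hSig hPsi hle k (F := F) hF t
  have hX : Measurable (RemoteEstimation.innov p s μ (k + 1)) :=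
    (RemoteEstimation.measurable_innov hloop k).mono
      (RemoteEstimation.sensorChannelInfo_le hloop _ _) le_rfl
  have hm := (RemoteEstimation.remoteInfo_le_sensorChannelInfo (p := p) (s := s) (μ := μ) k).trans
    (RemoteEstimation.sensorChannelInfo_le hloop k k)
  have hτ := (RemoteEstimation.measurable_holdingTime hloop.γ_zero k).mono
    (RemoteEstimation.channelInfo_le_remoteInfo (p := p) (s := s) (μ := μ) k) le_rfl
  have hpos := RemoteEstimation.measure_drop_pos hloop k
  have hD := RemoteEstimation.measurableSet_drop hloop (k + 1)
  have := cond_isProbabilityMeasure hpos.ne'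
  rw [Nat.add_sub_cancel]
  refine ⟨RemoteEstimation.hasCondLaw_of_fibers hX hm hτ
    (fun t => multivariateGaussian 0 (Sig t)) fun F hF t => (hlaw F hF t).1, hpos,
    RemoteEstimation.hasCondLaw_of_fibers hX hm hτ
      (fun t => multivariateGaussian 0 (Psi t)) fun F hF t => ?_⟩
  -- Conditioning on the drop is restriction followed by normalization, so the law on the drop
  -- passes to the conditioned measure.
  have hE := (hm F hF).inter ((hτ.mono hm le_rfl) (measurableSet_singleton t))
  rw [cond_apply hD, ProbabilityTheory.cond, Measure.restrict_smul, Measure.map_smul,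
    Measure.restrict_restrict hE, (hlaw F hF t).2, smul_smul, Set.inter_comm (s.γ (k + 1) ⁻¹' {0})]
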